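/- Let $(M,g)$ be a closed (compact, without boundary, nonempty) smooth Riemannian manifold, and let $\mu$ be its Riemannian measure divided by the total volume. For $u\in L^1(M,\mu)$ define the total variation $$TV(u):=\sup\Big\{\int_M u\,\operatorname{div}\phi\,d\mu \;:\; \phi \text{ a smooth vector field on } M,\ \|\phi\|_\infty\le 1\Big\}.$$ Let $BV(M)$ be the space of $u\in L^1(M,\mu)$ with $TV(u)<\infty$, with the norm $\|u\|_{BV}:=TV(u)+\|u\|_1$. Let $S$ be the unit sphere of $BV(M)$ and let $\Phi=S/\{\pm1\}$ be the corresponding projective space, with the quotient topology. On $BV(M)\setminus\{0\}$ consider the normalized energy $$\mathcal E(u):=\frac{TV(u)}{\int_M|u|\,d\mu},$$ which is even and therefore defines functions on $S$ and on $\Phi$. For a closed symmetric set $A\subset S$, let the Krasnoselskii genus $\gamma(A)$ be the least integer $m\ge 0$ for which there is an odd continuous map $A\to\mathbb R^m\setminus\{0\}$ (so $\gamma(\emptyset)=0$), and $\infty$ if there is no such $m$. For a closed set $A\subset\Phi$, let $\operatorname{cat}_\Phi(A)$ be the least number $m\ge 0$ of closed sets, each contractible in $\Phi$, that cover $A$,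 and $\infty$ if there is no such finite cover. Put $$\mathsf{kr}_2:=\inf_{\substack{A\subset S\text{ closed},\ A=-A\\ \gamma(A)\ge 2}}\ \sup_{A}\mathcal E,\qquad \mathsf{hs}_2:=\inf_{\substack{A\subset\Phi\text{ closed}\\ \operatorname{cat}_\Phi(A)\ge 2}}\ \sup_{A}\mathcal E .$$ A number $m\in\mathbb R$ is a median of $u$ if $\mu(\{u\le m\})\ge\frac12$ and $\mu(\{u\ge m\})\ge\frac12$. The Cheeger constant is $$h_1:=\inf\{\,TV(u)\;:\; u\in BV(M),\ \|u\|_1=1,\ 0\text{ is a median of }u\,\}.$$ All infima are taken in $[-\infty,+\infty]$, with $\inf\emptyset=+\infty$. **Theorem.** $\mathsf{kr}_2=h_1$ and $\mathsf{hs}_2=h_1$. -/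

import Mathlib

open Bundle MeasureTheory Set Filter Topology
open scoped Manifold ContDiff ENNReal

noncomputable section
namespace NonlinearSpectrum

/-- The Krasnoselskii genus of a symmetric set `A`: the least `m` for which there is an odd
continuous map from `A` to `ℝ^m` without zero, and `⊤` if there is none. It is `0` exactly for the
empty set, since `ℝ^0` has no nonzero vector. -/
def genus {B : Type*} [NormedAddCommGroup B] (A : Set B) : ℕ∞ :=
  ⨅ (m : ℕ) (_ : ∃ h : B → EuclideanSpace ℝ (Fin m),
    ContinuousOn h A ∧ (∀ x ∈ A, h (-x) = -h x) ∧ ∀ x ∈ A, h x ≠ 0), (m : ℕ∞)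

/-- The `k`-th Krasnoselskii eigenvalue of a function `f` on the unit sphere of `B`: the infimum of
`sup_A f` over the closed symmetric subsets `A` of the sphere of genus at least `k`
(`⊤` if there are no such sets). -/
def kr {B : Type*} [NormedAddCommGroup B] (f : Metric.sphere (0 : B) 1 → ℝ) (k : ℕ) : EReal :=
  ⨅ (A : Set B) (_ : A ⊆ Metric.sphere (0 : B) 1 ∧ IsClosed A ∧ (∀ x ∈ A, -x ∈ A) ∧
      (k : ℕ∞) ≤ genus A),
    ⨆ (x : Metric.sphere (0 : B) 1) (_ : (x : B) ∈ A), (f x : EReal)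

/-- The relation on the unit sphere which identifies antipodes. -/
def antipodalSetoid (B : Type*) [NormedAddCommGroup B] : Setoid (Metric.sphere (0 : B) 1) where
  r x y := x = y ∨ x = -y
  iseqv :=
    { refl := fun _ => Or.inl rfl
      symm := by
        rintro x y (rfl | rfl)
        · exact Or.inl rfl
        · exact Or.inr (neg_neg y).symm
      trans := by
        rintro x y z (rfl | rfl) (rfl | rfl)
        · exact Or.inl rfl
        · exact Or.inr rfl
        · exact Or.inr rfl
        · exact Or.inl (neg_neg z) }

/-- The projective space of `B`: the unit sphere modulo the antipodal map, with the quotient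
topology. -/
def ProjectiveSpace (B : Type*) [NormedAddCommGroup B] : Type _ := Quotient (antipodalSetoid B)

instance (B : Type*) [NormedAddCommGroup B] : TopologicalSpace (ProjectiveSpace B) :=
  inferInstanceAs (TopologicalSpace (Quotient (antipodalSetoid B)))

/-- The function on projective space induced by an even function on the unit sphere. -/
def descend {B : Type*} [NormedAddCommGroup B] (f : Metric.sphere (0 : B) 1 → ℝ)
    (hf : ∀ x, f (-x) = f x) : ProjectiveSpace B → ℝ :=
  Quotient.lift f (by
    rintro x y (rfl | rfl)
    · rfl
    · exact hf y)

/-- A subset `C` is contractible in `Φ` if its inclusion into `Φ` is homotopic to a constant map. -/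
def IsContractibleIn {Φ : Type*} [TopologicalSpace Φ] (C : Set Φ) : Prop :=
  (⟨Subtype.val, continuous_subtype_val⟩ : C(C, Φ)).Nullhomotopic

/-- The Lusternik-Schnirelmann subspace category of `A` in `Φ`: the least number of closed sets,
contractible in `Φ`, that cover `A`, and `⊤` if there is no finite cover of this kind. -/
def category {Φ : Type*} [TopologicalSpace Φ] (A : Set Φ) : ℕ∞ :=
  ⨅ (m : ℕ) (_ : ∃ C : Fin m → Set Φ, (∀ i, IsClosed (C i) ∧ IsContractibleIn (C i)) ∧
    A ⊆ ⋃ i, C i), (m : ℕ∞)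

/-- The `k`-th eigenvalue of a function `f` on `Φ` defined with the category: the infimum of
`sup_A f` over the closed subsets `A` of category at least `k` (`⊤` if there are no such sets). -/
def hs {Φ : Type*} [TopologicalSpace Φ] (f : Φ → ℝ) (k : ℕ) : EReal :=
  ⨅ (A : Set Φ) (_ : IsClosed A ∧ (k : ℕ∞) ≤ category A), ⨆ (x : Φ) (_ : x ∈ A), (f x : EReal)

end NonlinearSpectrum

namespace Cheeger

/-- The model space `ℝ^n`. -/
abbrev Eucl (n : ℕ) := EuclideanSpace ℝ (Fin n)

/-! ## Calculus in `ℝ^n` used for the chart independence of the divergence -/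


theorem contDiff_det (n : ℕ) : ContDiff ℝ ∞ (fun A : Eucl n →L[ℝ] Eucl n => A.det) := by
  have : (fun A : Eucl n →L[ℝ] Eucl n => A.det) = fun A =>
      ∑ σ : Equiv.Perm (Fin n), (Equiv.Perm.sign σ : ℤ) • ∏ i, A (EuclideanSpace.single i 1) (σ i) := by
    ext A
    have h := LinearMap.det_toMatrix (EuclideanSpace.basisFun (Fin n) ℝ).toBasis (A : Eucl n →ₗ[ℝ] Eucl n)
    rw [ContinuousLinearMap.det, ← h, Matrix.det_apply]
    simp [LinearMap.toMatrix_apply, Units.smul_def]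
  rw [this]
  fun_prop

theorem fderiv_det_apply {n : ℕ} (A B : Eucl n →L[ℝ] Eucl n) (A' : Eucl n →L[ℝ] Eucl n)
    (h : A ∘L A' = ContinuousLinearMap.id ℝ _) :
    fderiv ℝ (fun A : Eucl n →L[ℝ] Eucl n => A.det) A B
      = A.det * LinearMap.trace ℝ (Eucl n) ((A' ∘L B : Eucl n →L[ℝ] Eucl n) : Eucl n →ₗ[ℝ] Eucl n) := by
  have hd : HasFDerivAt (fun A : Eucl n →L[ℝ] Eucl n => A.det) _ A :=
    ((contDiff_det n).differentiable (by simp) A).hasFDerivAt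
  have hl : HasDerivAt (fun s : ℝ => A + s • B) B 0 := by
    simpa using ((hasDerivAt_id (0:ℝ)).smul_const B).const_add A
  have h1 : HasDerivAt (fun s : ℝ => (A + s • B).det)
      (fderiv ℝ (fun A : Eucl n →L[ℝ] Eucl n => A.det) A B) 0 := by
    have hd' : HasFDerivAt (fun A : Eucl n →L[ℝ] Eucl n => A.det)
      (fderiv ℝ (fun A : Eucl n →L[ℝ] Eucl n => A.det) A) (A + (0:ℝ) • B) := by
      have e0 : A + (0:ℝ) • B = A := by ext; simp
      rw [e0]; exact hd
    exact hd'.comp_hasDerivAt (0:ℝ) hl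
  let b := (EuclideanSpace.basisFun (Fin n) ℝ).toBasis
  let N := LinearMap.toMatrix b b ((A' ∘L B : Eucl n →L[ℝ] Eucl n) : Eucl n →ₗ[ℝ] Eucl n)
  obtain ⟨q, hq⟩ : ∃ q : Polynomial ℝ, ∀ r : ℝ, (1 + r • N).det = 1 + N.trace * r + q.eval r * r ^ 2 :=
    ⟨_, fun r => Matrix.det_one_add_smul r N⟩
  have h2 : ∀ s : ℝ, (A + s • B).det = A.det * (1 + N.trace * s + q.eval s * s ^ 2) := by
    intro s
    have e1 : A + s • B = A ∘L (ContinuousLinearMap.id ℝ _ + s • (A' ∘L B)) := by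
      have : A ∘L (A' ∘L B) = B := by rw [← ContinuousLinearMap.comp_assoc, h]; rfl
      rw [ContinuousLinearMap.comp_add, ContinuousLinearMap.comp_smul, this]; rfl
    have e2 : LinearMap.toMatrix b b ((ContinuousLinearMap.id ℝ (Eucl n) + s • (A' ∘L B) : Eucl n →L[ℝ] Eucl n) : Eucl n →ₗ[ℝ] Eucl n)
        = 1 + s • N := by
      simp [N]
    rw [e1, ← hq, ← e2, LinearMap.det_toMatrix]
    simp only [ContinuousLinearMap.det, ContinuousLinearMap.toLinearMap_comp, LinearMap.det_comp]
  have h3 : HasDerivAt (fun s : ℝ => (A + s • B).det) (A.det * N.trace) 0 := by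
    simp_rw [h2]
    have := (((hasDerivAt_id (0:ℝ)).const_mul N.trace).const_add 1).add
      ((q.hasDerivAt 0).mul ((hasDerivAt_id (0:ℝ)).pow 2))
    simpa using! this.const_mul A.det
  rw [h1.unique h3, LinearMap.trace_eq_matrix_trace ℝ b]

theorem div_chart_change {n : ℕ} {τ V V' : Eucl n → Eucl n} {r r' : Eucl n → ℝ} {y : Eucl n}
    (hτ : ContDiffAt ℝ 2 τ y) (A' : Eucl n →L[ℝ] Eucl n)
    (hA : fderiv ℝ τ y ∘L A' = ContinuousLinearMap.id ℝ _)
    (hV : DifferentiableAt ℝ V y) (hV' : DifferentiableAt ℝ V' (τ y))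
    (hr' : DifferentiableAt ℝ r' (τ y)) (hr0 : r' (τ y) ≠ 0)
    (hVV : ∀ᶠ z in 𝓝 y, V' (τ z) = fderiv ℝ τ z (V z))
    (hrr : ∀ᶠ z in 𝓝 y, r z = |(fderiv ℝ τ z).det| * r' (τ z)) :
    (r y)⁻¹ * LinearMap.trace ℝ (Eucl n) (fderiv ℝ (fun z => r z • V z) y : Eucl n →L[ℝ] Eucl n)
      = (r' (τ y))⁻¹ *
        LinearMap.trace ℝ (Eucl n) (fderiv ℝ (fun z => r' z • V' z) (τ y) : Eucl n →L[ℝ] Eucl n) := by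
  set A := fderiv ℝ τ y with hAdef
  have hA2 : A' ∘L A = ContinuousLinearMap.id ℝ _ := by
    have := mul_eq_one_comm.1 (congrArg ContinuousLinearMap.toLinearMap hA :
      (A : Eucl n →ₗ[ℝ] Eucl n) * (A' : Eucl n →ₗ[ℝ] Eucl n) = 1)
    exact ContinuousLinearMap.coe_injective this
  have hdet : A.det ≠ 0 := by
    intro h0
    have := congrArg ContinuousLinearMap.det hA
    simp only [ContinuousLinearMap.det, ContinuousLinearMap.toLinearMap_comp, LinearMap.det_comp] at this h0
    rw [h0] at this
    simp at this
  have hD : DifferentiableAt ℝ (fderiv ℝ τ) y :=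
    (hτ.fderiv_right (m := 1) (by norm_num)).differentiableAt (by simp)
  have hτd : DifferentiableAt ℝ τ y := hτ.differentiableAt (by simp)
  have hsymm : ∀ v w, fderiv ℝ (fderiv ℝ τ) y v w = fderiv ℝ (fderiv ℝ τ) y w v :=
    fun v w => (hτ.isSymmSndFDerivAt (by simp)) v w
  have hJ : DifferentiableAt ℝ (fun A : Eucl n →L[ℝ] Eucl n => A.det) (fderiv ℝ τ y) :=
    (contDiff_det n).differentiable (by simp) _
  have hJ2 : HasFDerivAt (fun z => (fderiv ℝ τ z).det)
    ((fderiv ℝ (fun A : Eucl n →L[ℝ] Eucl n => A.det) A) ∘L (fderiv ℝ (fderiv ℝ τ) y)) y :=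
    hJ.hasFDerivAt.comp y hD.hasFDerivAt
  have hJ3 := hJ2.abs hdet
  have hr1 := (hJ3.mul (hr'.hasFDerivAt.comp y hτd.hasFDerivAt)).congr_of_eventuallyEq hrr
  have hry : r y = |A.det| * r' (τ y) := hrr.self_of_nhds
  have hVy : V' (τ y) = A (V y) := hVV.self_of_nhds
  have habs : |A.det| ≠ 0 := by simpa using hdet
  -- derivative of the transported field
  have hL : HasFDerivAt (fun z => V' (τ z)) (fderiv ℝ V' (τ y) ∘L A) y :=
    hV'.hasFDerivAt.comp y hτd.hasFDerivAt
  have hR := (hD.hasFDerivAt.clm_apply hV.hasFDerivAt).congr_of_eventuallyEq hVV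
  have hLR := hL.unique hR
  have tr1 : LinearMap.trace ℝ (Eucl n) (fderiv ℝ V' (τ y) : Eucl n →L[ℝ] Eucl n) =
      LinearMap.trace ℝ (Eucl n) (fderiv ℝ V y : Eucl n →L[ℝ] Eucl n) +
      LinearMap.trace ℝ (Eucl n) (A' ∘L (fderiv ℝ (fderiv ℝ τ) y (V y)) : Eucl n →L[ℝ] Eucl n) := by
    have e : A' ∘L (fderiv ℝ V' (τ y) ∘L A) = fderiv ℝ V y + A' ∘L (fderiv ℝ (fderiv ℝ τ) y (V y)) := by
      rw [hLR]
      ext1 v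
      have := congrArg (fun T : Eucl n →L[ℝ] Eucl n => T (fderiv ℝ V y v)) hA2
      simp at this
      simp [hsymm v (V y), ← hAdef, this]
    have e2 : LinearMap.trace ℝ (Eucl n) (A' ∘L (fderiv ℝ V' (τ y) ∘L A) : Eucl n →L[ℝ] Eucl n)
        = LinearMap.trace ℝ (Eucl n) (fderiv ℝ V' (τ y) : Eucl n →L[ℝ] Eucl n) := by
      have := LinearMap.trace_mul_comm ℝ (A' : Eucl n →ₗ[ℝ] Eucl n)
        ((fderiv ℝ V' (τ y) ∘L A : Eucl n →L[ℝ] Eucl n) : Eucl n →ₗ[ℝ] Eucl n)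
      refine Eq.trans this ?_
      congr 1
      ext1 v
      have := congrArg (fun T : Eucl n →L[ℝ] Eucl n => T v) hA
      simp at this
      simp [this]
    rw [← e2, e]
    simp
  have key : ∀ {s : Eucl n → ℝ} {W : Eucl n → Eucl n} {z : Eucl n} {s' : Eucl n →L[ℝ] ℝ}, HasFDerivAt s s' z →
      DifferentiableAt ℝ W z →
      LinearMap.trace ℝ (Eucl n) (fderiv ℝ (fun z => s z • W z) z : Eucl n →L[ℝ] Eucl n)
        = s z * LinearMap.trace ℝ (Eucl n) (fderiv ℝ W z : Eucl n →L[ℝ] Eucl n) + s' (W z) := by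
    intro s W z s' hs hW
    have h0 : HasFDerivAt (fun z => s z • W z) _ z := hs.smul hW.hasFDerivAt
    rw [h0.fderiv]
    have : ((s'.smulRight (W z) : Eucl n →L[ℝ] Eucl n) : Eucl n →ₗ[ℝ] Eucl n)
      = LinearMap.smulRight (s' : Eucl n →ₗ[ℝ] ℝ) (W z) := rfl
    simp
  rw [key hr1 hV, key hr'.hasFDerivAt hV', tr1, hVy, hry]
  have hsg : (SignType.sign A.det : ℝ) * A.det = |A.det| := sign_mul_self _
  simp only [add_apply, smul_apply, smul_eq_mul,
    ContinuousLinearMap.comp_apply, fderiv_det_apply A _ A' hA, ← hAdef]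
  rw [← mul_assoc (SignType.sign A.det : ℝ), hsg]
  field_simp
  simp
  ring


theorem trace_eq_sum {n : ℕ} (A : Eucl n →L[ℝ] Eucl n) :
    LinearMap.trace ℝ (Eucl n) (A : Eucl n →ₗ[ℝ] Eucl n) = ∑ i, A (EuclideanSpace.single i 1) i := by
  rw [LinearMap.trace_eq_matrix_trace ℝ (EuclideanSpace.basisFun (Fin n) ℝ).toBasis]
  simp [Matrix.trace, LinearMap.toMatrix_apply]

/-! ## Metric and divergence in charts -/

variable {n : ℕ} {M : Type*} [TopologicalSpace M] [ChartedSpace (Eucl n) M] [IsManifold (𝓡 n) ∞ M]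

variable (n M) in
/-- Smooth Riemannian metrics on `M`. -/
abbrev RiemMetric := ContMDiffRiemannianMetric (𝓡 n) ∞ (Eucl n) (fun x : M => TangentSpace (𝓡 n) x)

/-- The coordinate vector `∂_i`, in the chart around `x₀`, at the point with coordinates `y`. -/
def coordVec (x₀ : M) (y : Eucl n) (i : Fin n) : TangentSpace (𝓡 n) ((extChartAt (𝓡 n) x₀).symm y) :=
  mfderiv 𝓘(ℝ, Eucl n) (𝓡 n) (extChartAt (𝓡 n) x₀).symm y (EuclideanSpace.single i (1 : ℝ) : Eucl n)

/-- The matrix `g_ij = g(∂_i, ∂_j)` of the metric in the chart around `x₀`. -/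
def metricMatrix (g : RiemMetric n M) (x₀ : M) (y : Eucl n) : Matrix (Fin n) (Fin n) ℝ :=
  Matrix.of fun i j =>
    g.inner ((extChartAt (𝓡 n) x₀).symm y) (coordVec x₀ y i) (coordVec x₀ y j)

/-- The volume density `√(det g_ij)` in the chart around `x₀`. -/
def density (g : RiemMetric n M) (x₀ : M) (y : Eucl n) : ℝ := √(metricMatrix g x₀ y).det

/-- The components `(X^1, …, X^n)` of a vector field in the chart around `x₀`: the preimage of `X`
under the derivative of the inverse chart. -/
def coordField (X : ∀ x : M, TangentSpace (𝓡 n) x) (x₀ : M) (y : Eucl n) : Eucl n :=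
  VectorField.mpullback 𝓘(ℝ, Eucl n) (𝓡 n) (extChartAt (𝓡 n) x₀).symm X y

/-- The coordinate expression `(1/√(det g)) ∑ i, ∂_i (√(det g) X^i)` of the divergence, in the chart
around `x₀`. -/
def chartDivergence (g : RiemMetric n M) (X : ∀ x : M, TangentSpace (𝓡 n) x) (x₀ : M) (y : Eucl n) : ℝ :=
  (density g x₀ y)⁻¹ *
    ∑ i, fderiv ℝ (fun z => density g x₀ z • coordField X x₀ z) y (EuclideanSpace.single i 1) i

/-- The divergence of a vector field, computed at each point in the preferred chart there. By
`chartDivergence_eq` every other chart gives the same value. -/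
def divergence (g : RiemMetric n M) (X : ∀ x : M, TangentSpace (𝓡 n) x) (x : M) : ℝ :=
  chartDivergence g X x (extChartAt (𝓡 n) x x)

/-- `X` is a smooth section of the tangent bundle. -/
def IsSmoothField (X : ∀ x : M, TangentSpace (𝓡 n) x) : Prop :=
  ContMDiff (𝓡 n) (𝓡 n).tangent ∞ (fun x => (⟨x, X x⟩ : TangentBundle (𝓡 n) M))

theorem isInvertible_symm {x₀ : M} {y : Eucl n} (hy : y ∈ (extChartAt (𝓡 n) x₀).target) :
    (mfderiv 𝓘(ℝ, Eucl n) (𝓡 n) (extChartAt (𝓡 n) x₀).symm y).IsInvertible := by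
  have := isInvertible_mfderivWithin_extChartAt_symm (I := 𝓡 n) hy
  simpa using this

theorem contMDiffAt_symm {x₀ : M} {y : Eucl n} (hy : y ∈ (extChartAt (𝓡 n) x₀).target) :
    ContMDiffAt 𝓘(ℝ, Eucl n) (𝓡 n) ∞ (extChartAt (𝓡 n) x₀).symm y :=
  (contMDiffOn_extChartAt_symm x₀).contMDiffAt ((isOpen_extChartAt_target x₀).mem_nhds hy)

theorem contDiffAt_coordField {X : ∀ x : M, TangentSpace (𝓡 n) x} (hX : IsSmoothField X)
    {x₀ : M} {y : Eucl n} (hy : y ∈ (extChartAt (𝓡 n) x₀).target) :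
    ContDiffAt ℝ ∞ (coordField X x₀) y := by
  have := ContMDiffAt.mpullback_vectorField_preimage (m := ∞) (hX ((extChartAt (𝓡 n) x₀).symm y))
    (contMDiffAt_symm hy) (isInvertible_symm hy) (by simp)
  exact contMDiffAt_vectorSpace_iff_contDiffAt.1 this

theorem contDiffAt_metricMatrix (g : RiemMetric n M) {x₀ : M} {y : Eucl n}
    (hy : y ∈ (extChartAt (𝓡 n) x₀).target) (i j : Fin n) :
    ContDiffAt ℝ ∞ (fun z => metricMatrix g x₀ z i j) y := by
  let _ : RiemannianBundle (fun x : M => TangentSpace (𝓡 n) x) := ⟨g.toRiemannianMetric⟩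
  have hv : ∀ i, ContMDiffAt 𝓘(ℝ, Eucl n) (𝓡 n).tangent ∞
      (fun z => (⟨(extChartAt (𝓡 n) x₀).symm z, coordVec x₀ z i⟩ : TangentBundle (𝓡 n) M)) y := by
    intro i
    have h1 : ContMDiffOn 𝓘(ℝ, Eucl n).tangent (𝓡 n).tangent ∞
        (tangentMapWithin 𝓘(ℝ, Eucl n) (𝓡 n) (extChartAt (𝓡 n) x₀).symm (extChartAt (𝓡 n) x₀).target) _ :=
      (contMDiffOn_extChartAt_symm (n := ∞) x₀).contMDiffOn_tangentMapWithin (by simp)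
        (isOpen_extChartAt_target x₀).uniqueMDiffOn
    have h2 : ContMDiffOn 𝓘(ℝ, Eucl n) 𝓘(ℝ, Eucl n).tangent ∞
       (fun z : Eucl n => (⟨z, (EuclideanSpace.single i (1:ℝ) : Eucl n)⟩ : TangentBundle 𝓘(ℝ, Eucl n) (Eucl n)))
       (extChartAt (𝓡 n) x₀).target := by
      intro z hz
      exact (contMDiffAt_vectorSpace_iff_contDiffAt (V := fun z => EuclideanSpace.single i (1:ℝ)).2
        contDiffAt_const).contMDiffWithinAt
    have h3 := (h1.comp h2 (fun z hz => hz)).contMDiffAt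
      ((isOpen_extChartAt_target x₀).mem_nhds hy)
    refine h3.congr_of_eventuallyEq ?_
    filter_upwards [(isOpen_extChartAt_target x₀).mem_nhds hy] with z hz
    simp only [tangentMapWithin, Function.comp, coordVec]
    rw [mfderivWithin_of_isOpen (isOpen_extChartAt_target x₀) hz]
  have := ContMDiffAt.inner_bundle (hv i) (hv j)
  exact this.contDiffAt


def frameMap (x₀ : M) (y : Eucl n) : Eucl n →L[ℝ] TangentSpace (𝓡 n) ((extChartAt (𝓡 n) x₀).symm y) :=
  mfderiv 𝓘(ℝ, Eucl n) (𝓡 n) (extChartAt (𝓡 n) x₀).symm y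

theorem form_aux {F : Type*} [TopologicalSpace F] [AddCommGroup F] [Module ℝ F]
    [IsTopologicalAddGroup F] [ContinuousConstSMul ℝ F]
    (B : F →L[ℝ] F →L[ℝ] ℝ) (D : Eucl n →L[ℝ] F) : ∃ L : Eucl n →ₗ[ℝ] Eucl n →ₗ[ℝ] ℝ,
      ∀ v w, L v w = B (D v) (D w) :=
  ⟨LinearMap.mk₂ ℝ (fun v w => B (D v) (D w))
    (by intros; simp) (by intros; simp) (by intros; simp) (by intros; simp), fun _ _ => rfl⟩

def metricForm (g : RiemMetric n M) (x₀ : M) (y : Eucl n) : Eucl n →ₗ[ℝ] Eucl n →ₗ[ℝ] ℝ :=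
  (form_aux (g.inner ((extChartAt (𝓡 n) x₀).symm y)) (frameMap x₀ y)).choose

theorem metricForm_apply (g : RiemMetric n M) (x₀ : M) (y v w : Eucl n) : metricForm g x₀ y v w =
    g.inner ((extChartAt (𝓡 n) x₀).symm y) (frameMap x₀ y v) (frameMap x₀ y w) :=
  (form_aux (g.inner ((extChartAt (𝓡 n) x₀).symm y)) (frameMap x₀ y)).choose_spec v w

theorem metricMatrix_eq (g : RiemMetric n M) (x₀ : M) (y : Eucl n) :
    metricMatrix g x₀ y = LinearMap.toMatrix₂ (EuclideanSpace.basisFun (Fin n) ℝ).toBasis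
      (EuclideanSpace.basisFun (Fin n) ℝ).toBasis (metricForm g x₀ y) := by
  ext i j
  rw [LinearMap.toMatrix₂_apply, metricForm_apply]
  simp only [OrthonormalBasis.coe_toBasis, EuclideanSpace.basisFun_apply]
  rfl

theorem metricMatrix_posDef (g : RiemMetric n M) {x₀ : M} {y : Eucl n}
    (hy : y ∈ (extChartAt (𝓡 n) x₀).target) : (metricMatrix g x₀ y).PosDef := by
  refine Matrix.PosDef.of_dotProduct_mulVec_pos ?_ ?_
  · ext i j
    exact g.symm _ _ _
  · intro v hv
    let b := (EuclideanSpace.basisFun (Fin n) ℝ).toBasis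
    let w : Eucl n := b.equivFun.symm v
    have hw : w ≠ 0 := fun h => hv ((map_eq_zero_iff _ b.equivFun.symm.injective).1 h)
    have h1 : star v ⬝ᵥ (metricMatrix g x₀ y).mulVec v = metricForm g x₀ y w w := by
      rw [metricMatrix_eq]
      exact dotProduct_toMatrix₂_mulVec b b (metricForm g x₀ y) v v
    rw [h1, metricForm_apply]
    apply g.pos
    intro h0
    apply hw
    obtain ⟨T, hT⟩ := isInvertible_symm hy
    have : T w = 0 := by rw [← h0]; exact congrArg (fun A => A w) hT
    exact (map_eq_zero_iff T T.injective).1 this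

theorem density_pos (g : RiemMetric n M) {x₀ : M} {y : Eucl n}
    (hy : y ∈ (extChartAt (𝓡 n) x₀).target) : 0 < density g x₀ y :=
  Real.sqrt_pos.2 (metricMatrix_posDef g hy).det_pos

theorem contDiffAt_density (g : RiemMetric n M) {x₀ : M} {y : Eucl n}
    (hy : y ∈ (extChartAt (𝓡 n) x₀).target) : ContDiffAt ℝ ∞ (density g x₀) y := by
  refine ContDiffAt.sqrt ?_ (metricMatrix_posDef g hy).det_pos.ne'
  have : (fun z => (metricMatrix g x₀ z).det) = fun z =>
      ∑ σ : Equiv.Perm (Fin n), ((Equiv.Perm.sign σ : ℤ) : ℝ) * ∏ i, metricMatrix g x₀ z (σ i) i := by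
    ext z
    rw [Matrix.det_apply']
  rw [this]
  exact ContDiffAt.sum fun σ _ => contDiffAt_const.mul
    (contDiffAt_prod fun i _ => contDiffAt_metricMatrix g hy _ _)

theorem inner_congr (g : RiemMetric n M) {p q : M} (h : p = q) (a b : Eucl n) :
    g.inner p (a : TangentSpace (𝓡 n) p) (b : TangentSpace (𝓡 n) p) =
      g.inner q (a : TangentSpace (𝓡 n) q) (b : TangentSpace (𝓡 n) q) := by
  subst h; rfl

theorem inverse_aux (D₀ D₁ A : Eucl n →L[ℝ] Eucl n) (h1 : D₁.IsInvertible) (hA : A.IsInvertible)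
    (h : D₀ = D₁ ∘L A) (v : Eucl n) : D₁.inverse v = A (D₀.inverse v) := by
  obtain ⟨T, rfl⟩ := h1
  obtain ⟨S, rfl⟩ := hA
  have : D₀ = ((S.trans T : Eucl n ≃L[ℝ] Eucl n) : Eucl n →L[ℝ] Eucl n) := h
  rw [this, ContinuousLinearMap.inverse_equiv, ContinuousLinearMap.inverse_equiv]
  simp

theorem frameMap_change {x₀ x₁ : M} {y : Eucl n} (hy : y ∈ (extChartAt (𝓡 n) x₀).target)
    (hy1 : (extChartAt (𝓡 n) x₀).symm y ∈ (extChartAt (𝓡 n) x₁).source) (g : RiemMetric n M) :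
    let τ := extChartAt (𝓡 n) x₁ ∘ (extChartAt (𝓡 n) x₀).symm
    ContDiffAt ℝ ∞ τ y ∧ (fderiv ℝ τ y).IsInvertible ∧
    metricForm g x₀ y = (metricForm g x₁ (τ y)).compl₁₂
      (fderiv ℝ τ y : Eucl n →ₗ[ℝ] Eucl n) (fderiv ℝ τ y : Eucl n →ₗ[ℝ] Eucl n)
      ∧ ∀ X, coordField X x₁ (τ y) = fderiv ℝ τ y (coordField X x₀ y) := by
  intro τ
  have hc1 : ContMDiffAt (𝓡 n) 𝓘(ℝ, Eucl n) ∞ (extChartAt (𝓡 n) x₁) ((extChartAt (𝓡 n) x₀).symm y) :=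
    contMDiffAt_extChartAt' (by simpa using hy1)
  have hτ : ContMDiffAt 𝓘(ℝ, Eucl n) 𝓘(ℝ, Eucl n) ∞ τ y :=
    hc1.comp y (contMDiffAt_symm hy)
  have hτy : τ y ∈ (extChartAt (𝓡 n) x₁).target := (extChartAt (𝓡 n) x₁).map_source hy1
  have hinv1 : (extChartAt (𝓡 n) x₁).symm (τ y) = (extChartAt (𝓡 n) x₀).symm y :=
    (extChartAt (𝓡 n) x₁).left_inv hy1
  have hev : (extChartAt (𝓡 n) x₀).symm =ᶠ[𝓝 y] (extChartAt (𝓡 n) x₁).symm ∘ τ := by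
    have : ∀ᶠ z in 𝓝 y, (extChartAt (𝓡 n) x₀).symm z ∈ (extChartAt (𝓡 n) x₁).source :=
      (contMDiffAt_symm hy).continuousAt.eventually ((isOpen_extChartAt_source x₁).mem_nhds hy1)
    filter_upwards [this] with z hz
    exact ((extChartAt (𝓡 n) x₁).left_inv hz).symm
  have hcomp : mfderiv 𝓘(ℝ, Eucl n) (𝓡 n) ((extChartAt (𝓡 n) x₁).symm ∘ τ) y =
      (mfderiv 𝓘(ℝ, Eucl n) (𝓡 n) (extChartAt (𝓡 n) x₁).symm (τ y)) ∘L
        (mfderiv 𝓘(ℝ, Eucl n) 𝓘(ℝ, Eucl n) τ y) :=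
    mfderiv_comp y ((contMDiffAt_symm hτy).mdifferentiableAt (by simp))
      (hτ.mdifferentiableAt (by simp))
  have hcomp' : mfderiv 𝓘(ℝ, Eucl n) 𝓘(ℝ, Eucl n) τ y =
      (mfderiv (𝓡 n) 𝓘(ℝ, Eucl n) (extChartAt (𝓡 n) x₁) ((extChartAt (𝓡 n) x₀).symm y)) ∘L
        (mfderiv 𝓘(ℝ, Eucl n) (𝓡 n) (extChartAt (𝓡 n) x₀).symm y) :=
    mfderiv_comp y (hc1.mdifferentiableAt (by simp))
      ((contMDiffAt_symm hy).mdifferentiableAt (by simp))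
  rw [← hev.mfderiv_eq, mfderiv_eq_fderiv] at hcomp
  rw [mfderiv_eq_fderiv] at hcomp'
  have hinvt : (fderiv ℝ τ y).IsInvertible := by
    have := (isInvertible_mfderiv_extChartAt (I := 𝓡 n) hy1).comp (isInvertible_symm hy)
    exact hcomp' ▸ this
  refine ⟨hτ.contDiffAt, hinvt, ?_, ?_⟩
  · refine LinearMap.ext₂ fun v w => ?_
    rw [LinearMap.compl₁₂_apply, metricForm_apply, metricForm_apply]
    have e : ∀ v, frameMap x₀ y v = frameMap x₁ (τ y) (fderiv ℝ τ y v) :=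
      fun v => congrArg (fun A => A v) hcomp
    refine (inner_congr g hinv1.symm _ _).trans ?_
    exact congrArg₂ (fun a b : Eucl n => g.inner ((extChartAt (𝓡 n) x₁).symm (τ y))
      (a : TangentSpace (𝓡 n) ((extChartAt (𝓡 n) x₁).symm (τ y)))
      (b : TangentSpace (𝓡 n) ((extChartAt (𝓡 n) x₁).symm (τ y)))) (e v) (e w)
  · intro X
    have hX : ∀ {p q : M}, p = q → (X p : Eucl n) = X q := by rintro p q rfl; rfl
    change (mfderiv 𝓘(ℝ, Eucl n) (𝓡 n) (extChartAt (𝓡 n) x₁).symm (τ y)).inverse _ =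
      fderiv ℝ τ y ((mfderiv 𝓘(ℝ, Eucl n) (𝓡 n) (extChartAt (𝓡 n) x₀).symm y).inverse _)
    rw [hX hinv1]
    exact inverse_aux _ _ _ (isInvertible_symm hτy) hinvt hcomp _

theorem chartDivergence_eq {x₀ x₁ p : M} (g : RiemMetric n M)
    {X : ∀ x : M, TangentSpace (𝓡 n) x} (hX : IsSmoothField X)
    (h0 : p ∈ (extChartAt (𝓡 n) x₀).source) (h1 : p ∈ (extChartAt (𝓡 n) x₁).source) :
    chartDivergence g X x₀ (extChartAt (𝓡 n) x₀ p) = 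
      chartDivergence g X x₁ (extChartAt (𝓡 n) x₁ p) := by
  set y := extChartAt (𝓡 n) x₀ p with hy
  set τ := extChartAt (𝓡 n) x₁ ∘ (extChartAt (𝓡 n) x₀).symm with hτ
  have hyp : (extChartAt (𝓡 n) x₀).symm y = p := (extChartAt (𝓡 n) x₀).left_inv h0
  have hyt : y ∈ (extChartAt (𝓡 n) x₀).target := (extChartAt (𝓡 n) x₀).map_source h0
  have hτy : τ y = extChartAt (𝓡 n) x₁ p := by simp only [hτ, Function.comp, hyp]
  have hy1 : (extChartAt (𝓡 n) x₀).symm y ∈ (extChartAt (𝓡 n) x₁).source := by rwa [hyp]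
  have hτt : τ y ∈ (extChartAt (𝓡 n) x₁).target := hτy ▸ (extChartAt (𝓡 n) x₁).map_source h1
  have hev : ∀ᶠ z in 𝓝 y, z ∈ (extChartAt (𝓡 n) x₀).target ∧
      (extChartAt (𝓡 n) x₀).symm z ∈ (extChartAt (𝓡 n) x₁).source :=
    Filter.Eventually.and ((isOpen_extChartAt_target x₀).mem_nhds hyt)
      ((contMDiffAt_symm hyt).continuousAt.eventually ((isOpen_extChartAt_source x₁).mem_nhds hy1))
  obtain ⟨hs, ⟨T, hT⟩, -, -⟩ := frameMap_change hyt hy1 g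
  rw [← hτ] at hs hT
  rw [← hτy]
  have := div_chart_change (τ := τ) (V := coordField X x₀) (V' := coordField X x₁)
    (r := density g x₀) (r' := density g x₁) (y := y) (hs.of_le (by norm_cast)) (T.symm)
    (by rw [← hT]; simp) ((contDiffAt_coordField hX hyt).differentiableAt (by simp))
    ((contDiffAt_coordField hX hτt).differentiableAt (by simp))
    ((contDiffAt_density g hτt).differentiableAt (by simp)) (density_pos g hτt).ne'
    (hev.mono fun z hz => (frameMap_change hz.1 hz.2 g).2.2.2 X)
    (hev.mono fun z hz => by
      have h := (frameMap_change hz.1 hz.2 g).2.2.1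
      rw [← hτ] at h
      rw [density, density, metricMatrix_eq, metricMatrix_eq, h,
        LinearMap.toMatrix₂_compl₁₂ (EuclideanSpace.basisFun (Fin n) ℝ).toBasis
        (EuclideanSpace.basisFun (Fin n) ℝ).toBasis (EuclideanSpace.basisFun (Fin n) ℝ).toBasis
        (EuclideanSpace.basisFun (Fin n) ℝ).toBasis, Matrix.det_mul, Matrix.det_mul, Matrix.det_transpose,
        LinearMap.det_toMatrix, mul_right_comm, Real.sqrt_mul' , Real.sqrt_mul_self_eq_abs]
      rw [← metricMatrix_eq]
      exact (metricMatrix_posDef g ((extChartAt (𝓡 n) x₁).map_source hz.2)).det_pos.le)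
  rw [trace_eq_sum, trace_eq_sum] at this
  exact this

theorem continuous_divergence (g : RiemMetric n M)
    {X : ∀ x : M, TangentSpace (𝓡 n) x} (hX : IsSmoothField X) : Continuous (divergence g X) := by
  rw [continuous_iff_continuousAt]
  intro x
  have hx := mem_extChartAt_target (I := 𝓡 n) x
  have h1 : ContinuousAt (chartDivergence g X x) (extChartAt (𝓡 n) x x) := by
    have hd : ContDiffAt ℝ ∞ (fun z => density g x z • coordField X x z) (extChartAt (𝓡 n) x x) :=
      (contDiffAt_density g hx).smul (contDiffAt_coordField hX hx)
    have hf := (hd.fderiv_right (m := ∞) (by simp)).continuousAt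
    refine ((contDiffAt_density g hx).continuousAt.inv₀ (density_pos g hx).ne').mul ?_
    refine tendsto_finsetSum _ fun i _ => ?_
    have h2 := hf.clm_apply (continuousAt_const (y := (EuclideanSpace.single i (1:ℝ) : Eucl n)))
    exact (EuclideanSpace.proj (𝕜 := ℝ) i).continuous.continuousAt.comp h2
  refine (h1.comp (continuousAt_extChartAt (I := 𝓡 n) x)).congr ?_
  filter_upwards [extChartAt_source_mem_nhds (I := 𝓡 n) x] with p hp
  exact chartDivergence_eq g hX hp (mem_extChartAt_source p)


/-- Smooth vector fields of sup norm at most one. -/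
def IsTestField (g : RiemMetric n M) (X : ∀ x : M, TangentSpace (𝓡 n) x) : Prop :=
  IsSmoothField X ∧ ∀ x, √(g.inner x (X x) (X x)) ≤ 1

theorem divergence_neg (g : RiemMetric n M) (X : ∀ x : M, TangentSpace (𝓡 n) x) (x : M) :
    divergence g (-X) x = - divergence g X x := by
  have h : ∀ z, density g x z • coordField (-X) x z = - (density g x z • coordField X x z) := by
    intro z
    rw [← smul_neg]
    congr 1
    exact VectorField.mpullback_neg_apply
  simp [divergence, chartDivergence, h]

theorem IsTestField.neg {g : RiemMetric n M} {X : ∀ x : M, TangentSpace (𝓡 n) x}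
    (hX : IsTestField g X) : IsTestField g (-X) := by
  refine ⟨?_, fun x => by simpa using hX.2 x⟩
  exact ContMDiff.neg_section hX.1

/-! ## Measure, total variation and functions of bounded variation -/

variable [MeasurableSpace M]

/-- The measure `√(det g) dy` of the chart around `x₀`, transported to the chart domain in `M`. -/
def chartVolume (g : RiemMetric n M) (x₀ : M) : Measure M :=
  (((volume : Measure (Eucl n)).restrict (extChartAt (𝓡 n) x₀).target).withDensity
    fun y => ENNReal.ofReal (density g x₀ y)).map (extChartAt (𝓡 n) x₀).symm

/-- The Riemannian measure: the least measure that dominates `√(det g) dy` on each chart domain.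
The chart measures agree on overlaps, so it restricts to `√(det g) dy` on each chart domain. -/
def riemannianVolume (g : RiemMetric n M) : Measure M := ⨆ x₀ : M, chartVolume g x₀

/-- The Riemannian measure divided by the total volume. -/
def normalizedVolume (g : RiemMetric n M) : Measure M :=
  (riemannianVolume g Set.univ)⁻¹ • riemannianVolume g

/-- The space `L¹(M)` of the normalized measure. -/
abbrev L1 (g : RiemMetric n M) := Lp ℝ 1 (normalizedVolume g)

/-- The total variation, the supremum of `∫ u div X` over the test fields. The field `X = 0` makes
it nonnegative, so negative values of the integral may be cut off at `0`. -/
def totalVariation (g : RiemMetric n M) (u : L1 g) : ℝ≥0∞ :=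
  ⨆ (X : ∀ x : M, TangentSpace (𝓡 n) x) (_ : IsTestField g X),
    ENNReal.ofReal (∫ x, u x * divergence g X x ∂(normalizedVolume g))

theorem integrable_mul_divergence [BorelSpace M] [CompactSpace M] (g : RiemMetric n M) {X : ∀ x : M, TangentSpace (𝓡 n) x}
    (hX : IsSmoothField X) (u : L1 g) :
    Integrable (fun x => u x * divergence g X x) (normalizedVolume g) := by
  have hc := continuous_divergence g hX
  obtain ⟨C, hC⟩ := isCompact_univ.exists_bound_of_continuousOn hc.continuousOn
  exact (L1.integrable_coeFn u).mul_bdd (c := C) hc.measurable.aestronglyMeasurable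
    (Eventually.of_forall fun x => hC x (Set.mem_univ x))

theorem totalVariation_zero (g : RiemMetric n M) : totalVariation g 0 = 0 := by
  simp only [totalVariation, ENNReal.iSup_eq_zero]
  intro X hX
  rw [integral_eq_zero_of_ae]
  · simp
  · filter_upwards [Lp.coeFn_zero ℝ 1 (normalizedVolume g)] with x hx
    rw [hx, Pi.zero_apply, zero_mul]

theorem totalVariation_add_le [BorelSpace M] [CompactSpace M] (g : RiemMetric n M) (u v : L1 g) :
    totalVariation g (u + v) ≤ totalVariation g u + totalVariation g v := by
  refine iSup₂_le fun X hX => ?_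
  have h : ∫ x, (u + v : L1 g) x * divergence g X x ∂(normalizedVolume g) =
      ∫ x, u x * divergence g X x ∂(normalizedVolume g) +
      ∫ x, v x * divergence g X x ∂(normalizedVolume g) := by
    rw [← integral_add (integrable_mul_divergence g hX.1 u) (integrable_mul_divergence g hX.1 v)]
    refine integral_congr_ae ?_
    filter_upwards [Lp.coeFn_add u v] with x hx
    rw [hx, Pi.add_apply, add_mul]
  rw [h]
  exact ENNReal.ofReal_add_le.trans (add_le_add
    (le_iSup₂ (f := fun X (_ : IsTestField g X) =>
      ENNReal.ofReal (∫ x, u x * divergence g X x ∂(normalizedVolume g))) X hX)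
    (le_iSup₂ (f := fun X (_ : IsTestField g X) =>
      ENNReal.ofReal (∫ x, v x * divergence g X x ∂(normalizedVolume g))) X hX))

theorem totalVariation_smul_of_nonneg (g : RiemMetric n M) {c : ℝ} (hc : 0 ≤ c) (u : L1 g) :
    totalVariation g (c • u) = ENNReal.ofReal c * totalVariation g u := by
  simp only [totalVariation, ENNReal.mul_iSup]
  refine iSup_congr fun X => iSup_congr fun _ => ?_
  rw [← ENNReal.ofReal_mul hc, ← integral_const_mul]
  congr 1
  refine integral_congr_ae ?_
  filter_upwards [Lp.coeFn_smul c u] with x hx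
  rw [hx, Pi.smul_apply, smul_eq_mul, mul_assoc]

theorem totalVariation_neg (g : RiemMetric n M) (u : L1 g) :
    totalVariation g (-u) = totalVariation g u := by
  have key : ∀ u : L1 g, totalVariation g (-u) ≤ totalVariation g u := by
    intro u
    refine iSup₂_le fun X hX => ?_
    refine le_of_eq_of_le ?_ (le_iSup₂ (f := fun X (_ : IsTestField g X) =>
      ENNReal.ofReal (∫ x, u x * divergence g X x ∂(normalizedVolume g))) (-X) hX.neg)
    congr 1
    refine integral_congr_ae ?_
    filter_upwards [Lp.coeFn_neg u] with x hx
    rw [hx, divergence_neg, Pi.neg_apply]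
    ring
  exact le_antisymm (key u) (by simpa using key (-u))

theorem totalVariation_smul (g : RiemMetric n M) (c : ℝ) (u : L1 g) :
    totalVariation g (c • u) = ENNReal.ofReal |c| * totalVariation g u := by
  rcases le_total 0 c with hc | hc
  · rw [abs_of_nonneg hc, totalVariation_smul_of_nonneg g hc]
  · rw [abs_of_nonpos hc, ← totalVariation_smul_of_nonneg g (neg_nonneg.2 hc), neg_smul,
      totalVariation_neg]

variable [BorelSpace M] [CompactSpace M]

/-- The functions in `L¹(M)` of finite total variation. -/
def bvSubmodule (g : RiemMetric n M) : Submodule ℝ (L1 g) where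
  carrier := {u | totalVariation g u < ⊤}
  zero_mem' := by simp [totalVariation_zero]
  add_mem' hu hv := (totalVariation_add_le g _ _).trans_lt (ENNReal.add_lt_top.2 ⟨hu, hv⟩)
  smul_mem' c u hu := by
    simpa [totalVariation_smul] using ENNReal.mul_lt_top ENNReal.ofReal_lt_top hu

/-- The space `BV(M)`, with the norm `TV(u) + ‖u‖₁` (not the norm inherited from `L¹(M)`). -/
def BV (g : RiemMetric n M) : Type _ := bvSubmodule g

namespace BV

variable {g : RiemMetric n M}

instance : AddCommGroup (BV g) := inferInstanceAs (AddCommGroup (bvSubmodule g))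
instance : Module ℝ (BV g) := inferInstanceAs (Module ℝ (bvSubmodule g))

/-- The underlying `L¹` function. -/
def toL1 : BV g →ₗ[ℝ] L1 g := (bvSubmodule g).subtype

/-- The total variation as a real number. -/
def tv (u : BV g) : ℝ := (totalVariation g u.toL1).toReal

theorem tv_ne_top (u : BV g) : totalVariation g u.toL1 ≠ ⊤ := (show totalVariation g u.toL1 < ⊤ from u.2).ne

theorem tv_smul (c : ℝ) (u : BV g) : tv (c • u) = |c| * tv u := by
  rw [tv, map_smul, totalVariation_smul, ENNReal.toReal_mul, ENNReal.toReal_ofReal (abs_nonneg c)]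
  rfl

theorem tv_neg (u : BV g) : tv (-u) = tv u := by
  rw [← neg_one_smul ℝ u, tv_smul]; simp

theorem tv_add_le (u v : BV g) : tv (u + v) ≤ tv u + tv v := by
  rw [tv, tv, tv, ← ENNReal.toReal_add u.tv_ne_top v.tv_ne_top, map_add]
  exact ENNReal.toReal_mono (ENNReal.add_ne_top.2 ⟨u.tv_ne_top, v.tv_ne_top⟩)
    (totalVariation_add_le g _ _)

instance : Norm (BV g) := ⟨fun u => tv u + ‖u.toL1‖⟩

theorem norm_def (u : BV g) : ‖u‖ = tv u + ‖u.toL1‖ := rfl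

theorem core : NormedSpace.Core ℝ (BV g) where
  norm_nonneg u := add_nonneg ENNReal.toReal_nonneg (norm_nonneg _)
  norm_smul c u := by
    rw [norm_def, norm_def, tv_smul, map_smul, norm_smul, Real.norm_eq_abs, mul_add]
  norm_triangle u v := by
    rw [norm_def, norm_def, norm_def, map_add]
    linarith [tv_add_le u v, norm_add_le u.toL1 v.toL1]
  norm_eq_zero_iff u := by
    constructor
    · intro h
      have h1 : ‖u.toL1‖ = 0 := le_antisymm
        (by rw [← h, norm_def]; exact le_add_of_nonneg_left ENNReal.toReal_nonneg) (norm_nonneg _)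
      exact Subtype.ext (norm_eq_zero.1 h1)
    · rintro rfl
      rw [norm_def, tv, map_zero, totalVariation_zero]
      simp

instance : NormedAddCommGroup (BV g) := NormedAddCommGroup.ofCore core
instance : NormedSpace ℝ (BV g) := NormedSpace.ofCore core

end BV

/-! ## Energy and Cheeger constant -/

/-- `m` is a median of `u`. -/
def IsMedian {Ω : Type*} [MeasurableSpace Ω] (μ : Measure Ω) (u : Ω → ℝ) (m : ℝ) : Prop :=
  1 / 2 ≤ μ {x | u x ≤ m} ∧ 1 / 2 ≤ μ {x | m ≤ u x}

/-- The Cheeger constant: the infimum of `TV(u)` over the `u` in `BV(M)` with `‖u‖₁ = 1` and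
median `0`. -/
def cheegerConstant (g : RiemMetric n M) : EReal :=
  ⨅ (u : BV g) (_ : ‖u.toL1‖ = 1 ∧ IsMedian (normalizedVolume g) u.toL1 0), (u.tv : EReal)

/-- The normalized energy `TV(u) / ∫ |u|`. -/
def energy {g : RiemMetric n M} (u : BV g) : ℝ :=
  u.tv / ∫ x, |u.toL1 x| ∂(normalizedVolume g)

theorem energy_neg {g : RiemMetric n M} (u : BV g) : energy (-u) = energy u := by
  have h : ∫ x, |(-u).toL1 x| ∂(normalizedVolume g) = ∫ x, |u.toL1 x| ∂(normalizedVolume g) := by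
    rw [map_neg]
    refine integral_congr_ae ?_
    filter_upwards [Lp.coeFn_neg u.toL1] with x hx
    rw [hx, Pi.neg_apply, abs_neg]
  rw [energy, energy, BV.tv_neg, h]

/-- The normalized energy on the unit sphere of `BV(M)`. -/
def sphereEnergy (g : RiemMetric n M) (u : Metric.sphere (0 : BV g) 1) : ℝ := energy (u : BV g)

/-- The normalized energy on the projective space of `BV(M)`. -/
def projectiveEnergy (g : RiemMetric n M) : NonlinearSpectrum.ProjectiveSpace (BV g) → ℝ :=
  NonlinearSpectrum.descend (sphereEnergy g) fun u => energy_neg (u : BV g)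

end Cheeger

end

/-! The proof is the cycle h₁ ≤ hs₂ ≤ kr₂ ≤ h₁, and none of the infima has to be attained.

kr₂ ≤ h₁ (`kr_le_cheegerConstant`). For `u` with `‖u‖₁ = 1` and median 0, take the unit circle of
the plane spanned by `u` and the constant 1. Its genus is at least 2 by the intermediate value
theorem. Constants have zero variation by the divergence theorem, so TV(au + b) ≤ |a| TV(u). A
median minimizes the L¹ distance to the constants, so ‖au + b‖₁ ≥ |a|. Hence the energy on the
circle is at most TV(u).

hs₂ ≤ kr₂ (`hs_two_le_kr_two`). The sphere covers projective space twice. If the image of a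
symmetric set lies in a contractible set, the contraction lifts to the sphere. Uniqueness of lifts
makes its end map odd, with values in a pair of antipodes, so the genus is at most 1
(`genus_le_one_of_isContractibleIn`).

h₁ ≤ hs₂ (`cheegerConstant_le_hs`). A closed set of category at least 2 must contain the class of a
function with median 0. Otherwise each class in it has exactly one representative that is positive
on more than half of `M`. By lower semicontinuity of μ{u > 0} in L¹ this choice is continuous, and
sliding the representatives along segments to the constant 1 contracts the set in projective space.
-/

namespace NonlinearSpectrum

/-! ### Projective space, the genus and the category -/

section Projective

variable {B : Type*} [NormedAddCommGroup B]

/-- The projection of the unit sphere onto the projective space. -/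
def ProjectiveSpace.mk (x : Metric.sphere (0 : B) 1) : ProjectiveSpace B :=
  Quotient.mk (antipodalSetoid B) x

theorem ProjectiveSpace.isQuotientMap_mk : IsQuotientMap (ProjectiveSpace.mk (B := B)) :=
  isQuotientMap_quotient_mk'

theorem ProjectiveSpace.mk_eq_mk {x y : Metric.sphere (0 : B) 1} :
    ProjectiveSpace.mk x = ProjectiveSpace.mk y ↔ x = y ∨ x = -y :=
  Quotient.eq (r := antipodalSetoid B)

theorem ProjectiveSpace.mk_neg (x : Metric.sphere (0 : B) 1) :
    ProjectiveSpace.mk (-x) = ProjectiveSpace.mk x :=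
  ProjectiveSpace.mk_eq_mk.2 (Or.inr rfl)

/-- The saturation of `U` is `U ∪ -U`. Openness later turns the projection of an antipode-free open
set into an open embedding. -/
theorem ProjectiveSpace.isOpenMap_mk : IsOpenMap (ProjectiveSpace.mk (B := B)) := by
  intro U hU
  rw [← ProjectiveSpace.isQuotientMap_mk.isOpen_preimage]
  have : ProjectiveSpace.mk ⁻¹' (ProjectiveSpace.mk '' U) = U ∪ (fun x => -x) ⁻¹' U := by
    ext x
    simp only [mem_preimage, mem_image, ProjectiveSpace.mk_eq_mk, mem_union]
    constructor
    · rintro ⟨y, hy, rfl | rfl⟩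
      · exact Or.inl hy
      · exact Or.inr hy
    · rintro (h | h)
      · exact ⟨x, h, Or.inl rfl⟩
      · exact ⟨-x, h, Or.inr rfl⟩
  rw [this]
  exact hU.union (hU.preimage continuous_neg)

/-- The image in projective space of a closed symmetric set is closed. -/
theorem ProjectiveSpace.isClosed_image_mk {A : Set (Metric.sphere (0 : B) 1)} (hA : IsClosed A)
    (hs : ∀ x ∈ A, -x ∈ A) : IsClosed (ProjectiveSpace.mk '' A) := by
  rw [← ProjectiveSpace.isQuotientMap_mk.isClosed_preimage]
  convert hA
  ext x
  simp only [mem_preimage, mem_image, ProjectiveSpace.mk_eq_mk]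
  constructor
  · rintro ⟨y, hy, rfl | rfl⟩
    · exact hy
    · simpa using hs _ hy
  · exact fun h => ⟨x, h, Or.inl rfl⟩

theorem descend_mk (f : Metric.sphere (0 : B) 1 → ℝ) (hf : ∀ x, f (-x) = f x)
    (x : Metric.sphere (0 : B) 1) : descend f hf (ProjectiveSpace.mk x) = f x := rfl

theorem unitSphere_eq_one_or_neg_one (r : Metric.sphere (0 : ℝ) 1) : r = 1 ∨ r = -1 := by
  have h : |(r : ℝ)| = 1 := mem_sphere_zero_iff_norm.1 r.2
  rcases (abs_eq zero_le_one).1 h with h | h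
  · exact Or.inl (Subtype.ext h)
  · exact Or.inr (Subtype.ext h)

/-- The group ±1, realized as the unit sphere of `ℝ`, acts by scalars, and antipodes are at distance
2, so small balls are disjoint from their negatives. This provides homotopy lifting. -/
theorem ProjectiveSpace.isQuotientCoveringMap_mk [NormedSpace ℝ B] :
    IsQuotientCoveringMap (ProjectiveSpace.mk (B := B)) (Metric.sphere (0 : ℝ) 1) where
  toIsQuotientMap := ProjectiveSpace.isQuotientMap_mk
  toContinuousConstSMul := inferInstance
  apply_eq_iff_mem_orbit {x y} := by
    have hneg : (-1 : Metric.sphere (0 : ℝ) 1) • y = -y := Subtype.ext (neg_one_smul ℝ (y : B))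
    rw [ProjectiveSpace.mk_eq_mk, MulAction.mem_orbit_iff]
    constructor
    · rintro (rfl | rfl)
      · exact ⟨1, one_smul _ _⟩
      · exact ⟨-1, hneg⟩
    · rintro ⟨r, rfl⟩
      rcases unitSphere_eq_one_or_neg_one r with rfl | rfl
      · exact Or.inl (one_smul _ _)
      · exact Or.inr hneg
  disjoint x := by
    refine ⟨Metric.ball x 1, Metric.ball_mem_nhds x one_pos, ?_⟩
    rintro r ⟨-, ⟨y, hy, rfl⟩, hy'⟩
    rcases unitSphere_eq_one_or_neg_one r with rfl | rfl
    · rfl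
    · exfalso
      have hneg : (-1 : Metric.sphere (0 : ℝ) 1) • y = -y := Subtype.ext (neg_one_smul ℝ (y : B))
      simp only [hneg, Metric.mem_ball] at hy hy'
      have h1 : dist y (-y) < 2 := by
        linarith [dist_triangle_right y (-y) x]
      rw [Subtype.dist_eq, dist_eq_norm, coe_neg_sphere, sub_neg_eq_add, ← two_smul ℝ, norm_smul,
        norm_eq_of_mem_sphere] at h1
      norm_num at h1

/-- A symmetric subset of the sphere whose image lies in a contractible set has genus at most one:
lift the contraction to the sphere. -/
theorem genus_le_one_of_isContractibleIn [NormedSpace ℝ B] {A : Set B}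
    (hA : A ⊆ Metric.sphere (0 : B) 1) (hs : ∀ x ∈ A, -x ∈ A) {C : Set (ProjectiveSpace B)}
    (hC : IsContractibleIn C) (hAC : ∀ x (hx : x ∈ A), ProjectiveSpace.mk ⟨x, hA hx⟩ ∈ C) :
    genus A ≤ 1 := by
  obtain ⟨y, ⟨F⟩⟩ := hC
  obtain ⟨p, rfl⟩ := ProjectiveSpace.isQuotientMap_mk.surjective y
  have cov := (ProjectiveSpace.isQuotientCoveringMap_mk (B := B)).isCoveringMap
  let j : C(A, Metric.sphere (0 : B) 1) := ⟨Set.inclusion hA, continuous_inclusion hA⟩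
  let q : C(A, C) := ⟨fun x => ⟨ProjectiveSpace.mk (j x), hAC x x.2⟩,
    (cov.continuous.comp j.continuous).subtype_mk _⟩
  let H : C(unitInterval × A, ProjectiveSpace B) :=
    ⟨fun z => F (z.1, q z.2), F.continuous.comp
      (continuous_fst.prodMk (q.continuous.comp continuous_snd))⟩
  have H0 : ∀ a, H (0, a) = ProjectiveSpace.mk (j a) := fun a => F.apply_zero _
  -- The contraction, pulled back to `A`, lifts to a homotopy in the sphere that starts at the
  -- inclusion.
  let K := cov.liftHomotopy H j H0
  have hK : ∀ z, ProjectiveSpace.mk (K z) = H z := congrFun (cov.liftHomotopy_lifts H j H0)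
  have hK0 : ∀ a, K (0, a) = j a := cov.liftHomotopy_zero H j H0
  let ν : A → A := fun x => ⟨-x, hs x x.2⟩
  have hν : Continuous ν := (continuous_neg.comp continuous_subtype_val).subtype_mk _
  have hq : ∀ a, q (ν a) = q a := fun a => Subtype.ext (ProjectiveSpace.mk_neg (j a))
  -- The conjugate of `K` by the antipodal map lifts the same homotopy from the same start.
  -- Uniqueness of lifts gives `K' = K`, so `K` is odd at every time.
  let K' : C(unitInterval × A, Metric.sphere (0 : B) 1) :=
    ⟨fun z => -K (z.1, ν z.2), (K.continuous.comp
      (continuous_fst.prodMk (hν.comp continuous_snd))).neg⟩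
  have hKK : K' = K := by
    refine (cov.eq_liftHomotopy_iff' H0 K').2 ⟨?_, ?_⟩
    · ext z
      change ProjectiveSpace.mk (-K (z.1, ν z.2)) = H z
      rw [ProjectiveSpace.mk_neg, hK]
      change F (z.1, q (ν z.2)) = F (z.1, q z.2)
      rw [hq]
    · intro a
      change -K (0, ν a) = j a
      rw [hK0]
      exact Subtype.ext (neg_neg _)
  have hodd : ∀ a, K (1, ν a) = -K (1, a) := by
    intro a
    have := congrArg (fun f => -(f (1, a))) hKK
    simpa [K'] using this
  have hend : ∀ a, K (1, a) = p ∨ K (1, a) = -p := by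
    intro a
    rw [← ProjectiveSpace.mk_eq_mk, hK]
    exact F.apply_one _
  -- An odd continuous function that does not vanish at `p` and `-p`, the only values of the lift at
  -- time 1.
  let d : B → ℝ := fun x => ‖x + p‖ - ‖x - p‖
  have hd : Continuous d := by fun_prop
  have hdodd : ∀ x, d (-x) = -d x := by
    intro x
    simp only [d]
    rw [← norm_neg (-x - p), ← norm_neg (-x + p), neg_sub, neg_add, neg_neg, sub_neg_eq_add,
      add_comm (p : B) x, ← sub_eq_add_neg, neg_sub]
  have hdp : d p ≠ 0 := by
    simp only [d, sub_self, norm_zero, sub_zero]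
    rw [← two_smul ℝ, norm_smul, norm_eq_of_mem_sphere]
    norm_num
  classical
  let s : A → ℝ := fun a => d (K (1, a))
  have hsc : Continuous s := hd.comp (continuous_subtype_val.comp
    (K.continuous.comp (continuous_const.prodMk continuous_id)))
  let h : B → EuclideanSpace ℝ (Fin 1) := fun x =>
    if hx : x ∈ A then EuclideanSpace.single 0 (s ⟨x, hx⟩) else 0
  have hh : ∀ a : A, h a = EuclideanSpace.single 0 (s a) := fun a => dif_pos a.2
  refine iInf₂_le (1 : ℕ) ⟨h, ?_, ?_, ?_⟩
  · rw [continuousOn_iff_continuous_domRestrict]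
    have : A.domRestrict h = fun a => EuclideanSpace.single 0 (s a) := funext hh
    rw [this]
    refine (PiLp.continuous_toLp 2 _).comp (continuous_pi fun i => ?_)
    fin_cases i
    simpa using hsc
  · intro x hx
    have e1 : h (-x) = EuclideanSpace.single 0 (s (ν ⟨x, hx⟩)) := hh (ν ⟨x, hx⟩)
    have e2 : h x = EuclideanSpace.single 0 (s ⟨x, hx⟩) := hh ⟨x, hx⟩
    rw [e1, e2]
    simp only [s]
    rw [hodd, coe_neg_sphere, hdodd]
    ext i
    fin_cases i
    simp
  · intro x hx
    have e2 : h x = EuclideanSpace.single 0 (s ⟨x, hx⟩) := hh ⟨x, hx⟩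
    rw [e2, Ne, PiLp.single_eq_zero_iff]
    simp only [s]
    rcases hend ⟨x, hx⟩ with e | e
    · rw [e]; exact hdp
    · rw [e, coe_neg_sphere, hdodd, neg_eq_zero]; exact hdp

theorem genus_empty : genus (∅ : Set B) = 0 :=
  le_antisymm (iInf₂_le (0 : ℕ) ⟨0, continuousOn_const, by simp, by simp⟩) bot_le

/-- The image in projective space of a symmetric set of genus at least two has category at least
two. -/
theorem two_le_category_of_two_le_genus [NormedSpace ℝ B] {A : Set B}
    (hA : A ⊆ Metric.sphere (0 : B) 1) (hs : ∀ x ∈ A, -x ∈ A) (h2 : 2 ≤ genus A) :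
    2 ≤ category (ProjectiveSpace.mk '' (Subtype.val ⁻¹' A : Set (Metric.sphere (0 : B) 1))) := by
  refine le_iInf₂ fun m hm => ?_
  by_contra hlt
  obtain ⟨C, hC, hcov⟩ := hm
  have hm2 : m < 2 := by
    rw [not_le] at hlt
    exact_mod_cast hlt
  have hmem : ∀ x (hx : x ∈ A), ∃ i, ProjectiveSpace.mk ⟨x, hA hx⟩ ∈ C i := fun x hx =>
    mem_iUnion.1 (hcov ⟨⟨x, hA hx⟩, hx, rfl⟩)
  have h1 : genus A ≤ 1 := by
    -- The category can also be 0: an empty cover forces `A = ∅`, of genus 0.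
    interval_cases m
    · have : A = ∅ := by
        refine eq_empty_of_forall_notMem fun x hx => ?_
        obtain ⟨i, -⟩ := hmem x hx
        exact i.elim0
      rw [this, genus_empty]
      exact zero_le_one
    · refine genus_le_one_of_isContractibleIn hA hs (hC 0).2 fun x hx => ?_
      obtain ⟨i, hi⟩ := hmem x hx
      rwa [Subsingleton.elim i 0] at hi
  exact absurd (h2.trans h1) (by decide)

/-- Every set that competes in `kr` projects to one that competes in `hs`, with the same values of
the function. -/
theorem hs_two_le_kr_two [NormedSpace ℝ B] (f : Metric.sphere (0 : B) 1 → ℝ)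
    (hf : ∀ x, f (-x) = f x) : hs (descend f hf) 2 ≤ kr f 2 := by
  refine le_iInf₂ fun A hA => ?_
  obtain ⟨hA, hcl, hs, h2⟩ := hA
  refine (iInf₂_le (ProjectiveSpace.mk '' (Subtype.val ⁻¹' A)) (And.intro ?_ ?_)).trans ?_
  · exact ProjectiveSpace.isClosed_image_mk (hcl.preimage continuous_subtype_val)
      fun x hx => hs x hx
  · exact two_le_category_of_two_le_genus hA hs h2
  · refine iSup₂_le ?_
    rintro - ⟨x, hx, rfl⟩
    rw [descend_mk]
    exact le_iSup₂ (f := fun (x : Metric.sphere (0 : B) 1) (_ : (x : B) ∈ A) => (f x : EReal)) x hx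

/-- The unit circle of a plane has genus at least two. -/
theorem two_le_genus_of_plane [NormedSpace ℝ B] {x y : B} (hxy : LinearIndependent ℝ ![x, y]) :
    2 ≤ genus ((Submodule.span ℝ {x, y} : Set B) ∩ Metric.sphere 0 1) := by
  refine le_iInf₂ fun m hm => ?_
  by_contra hlt
  obtain ⟨h, hc, hodd, hne⟩ := hm
  have hm2 : m < 2 := by
    rw [not_le] at hlt
    exact_mod_cast hlt
  set A := (Submodule.span ℝ {x, y} : Set B) ∩ Metric.sphere 0 1
  -- Half an ellipse from `x` to `-x`; normalized, it is a path in the circle between two antipodes.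
  let w : ℝ → B := fun t => Real.cos t • x + Real.sin t • y
  have hw0 : ∀ t, w t ≠ 0 := by
    intro t ht
    obtain ⟨h1, h2⟩ := LinearIndependent.pair_iff.1 hxy _ _ ht
    have := Real.cos_sq_add_sin_sq t
    rw [h1, h2] at this
    norm_num at this
  let v : ℝ → B := fun t => ‖w t‖⁻¹ • w t
  have hwc : Continuous w := by fun_prop
  have hvc : Continuous v := (hwc.norm.inv₀ fun t => norm_ne_zero_iff.2 (hw0 t)).smul hwc
  have hvA : ∀ t, v t ∈ A := by
    intro t
    refine ⟨Submodule.smul_mem _ _ (Submodule.add_mem _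
      (Submodule.smul_mem _ _ (Submodule.subset_span (by simp)))
      (Submodule.smul_mem _ _ (Submodule.subset_span (by simp)))), ?_⟩
    simp [v, norm_smul, hw0 t]
  have hvπ : v Real.pi = -v 0 := by simp [v, w]
  interval_cases m
  · exact hne _ (hvA 0) (Subsingleton.elim _ _)
  · have hφc : Continuous fun t => h (v t) 0 :=
      (EuclideanSpace.proj (𝕜 := ℝ) (0 : Fin 1)).continuous.comp
        (hc.comp_continuous hvc hvA)
    have hφ0 : ∀ t, h (v t) 0 ≠ 0 := by
      intro t ht
      refine hne _ (hvA t) ?_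
      ext i
      fin_cases i
      simpa using ht
    have hφπ : h (v Real.pi) 0 = -h (v 0) 0 := by
      rw [hvπ, hodd _ (hvA 0)]
      simp
    -- Oddness gives opposite values at the two ends, so the scalar map vanishes somewhere on the
    -- path.
    have hmem : (0 : ℝ) ∈ uIcc (h (v 0) 0) (h (v Real.pi) 0) := by
      rw [hφπ, mem_uIcc]
      rcases le_total (h (v 0) 0) 0 with h0 | h0
      · exact Or.inl ⟨h0, by linarith⟩
      · exact Or.inr ⟨by linarith, h0⟩
    obtain ⟨t, -, ht⟩ := intermediate_value_uIcc (hφc.continuousOn (s := uIcc 0 Real.pi)) hmem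
    exact hφ0 t ht

/-- A subset of projective space has category at most one if it is closed and lifts to an open
part of the sphere which contains no antipodes and is star-shaped around a point. -/
theorem category_le_one_of_subset [NormedSpace ℝ B] {A : Set (ProjectiveSpace B)}
    (hA : IsClosed A) {U : Set (Metric.sphere (0 : B) 1)} (hU : IsOpen U)
    (hanti : ∀ x ∈ U, -x ∉ U) {e : B}
    (hstar : ∀ x ∈ U, ∀ t ∈ Icc (0 : ℝ) 1, (1 - t) • (x : B) + t • e ≠ 0)
    (hAU : A ⊆ ProjectiveSpace.mk '' U) : category A ≤ 1 := by
  -- For nonempty `A` the set `U` has a point, and `hstar` at `t = 1` then yields `e ≠ 0`.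
  rcases A.eq_empty_or_nonempty with rfl | ⟨a₀, ha₀⟩
  · exact (iInf₂_le (0 : ℕ) ⟨fun i => i.elim0, fun i => i.elim0, empty_subset _⟩).trans zero_le_one
  refine iInf₂_le (1 : ℕ) ⟨fun _ => A, fun _ => ⟨hA, ?_⟩, subset_iUnion_of_subset 0 subset_rfl⟩
  obtain ⟨x₀, hx₀, -⟩ := hAU ha₀
  have he : e ≠ 0 := by simpa using hstar x₀ hx₀ 1 (by simp)
  let r : U → ProjectiveSpace B := fun x => ProjectiveSpace.mk x
  have hr : IsOpenEmbedding r := by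
    refine .of_continuous_injective_isOpenMap
      (ProjectiveSpace.isQuotientMap_mk.continuous.comp continuous_subtype_val) ?_
      (ProjectiveSpace.isOpenMap_mk.comp hU.isOpenMap_subtype_val)
    intro x y hxy
    rcases ProjectiveSpace.mk_eq_mk.1 hxy with h | h
    · exact Subtype.ext h
    · exact absurd (h ▸ x.2) (hanti _ y.2)
  have hAr : ∀ a : A, (a : ProjectiveSpace B) ∈ range r := by
    intro a
    obtain ⟨x, hx, hxa⟩ := hAU a.2
    exact ⟨⟨x, hx⟩, hxa⟩
  -- The inverse of the open embedding is a continuous choice of representatives over `A`.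
  let σ : A → U := fun a => hr.toIsEmbedding.toHomeomorph.symm ⟨a, hAr a⟩
  have hσ : Continuous σ := hr.toIsEmbedding.toHomeomorph.symm.continuous.comp
    (continuous_subtype_val.subtype_mk _)
  have hrσ : ∀ a, r (σ a) = a := fun a =>
    congrArg Subtype.val (hr.toIsEmbedding.toHomeomorph.apply_symm_apply ⟨a, hAr a⟩)
  -- The segment from the representative to `e` avoids 0, so it can be normalized and projected. The
  -- intermediate points need not stay over `A`.
  let w : unitInterval × A → B := fun z => (1 - (z.1 : ℝ)) • (σ z.2 : B) + (z.1 : ℝ) • e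
  have hw : Continuous w := by
    have : Continuous fun z : unitInterval × A => (σ z.2 : B) :=
      continuous_subtype_val.comp (continuous_subtype_val.comp (hσ.comp continuous_snd))
    fun_prop
  have hw0 : ∀ z, w z ≠ 0 := fun z => hstar _ (σ z.2).2 _ z.1.2
  have hsph : ∀ b : B, b ≠ 0 → ‖b‖⁻¹ • b ∈ Metric.sphere (0 : B) 1 := by
    intro b hb
    simp [norm_smul, hb]
  let k : unitInterval × A → Metric.sphere (0 : B) 1 := fun z => ⟨_, hsph (w z) (hw0 z)⟩
  have hk : Continuous k :=
    ((hw.norm.inv₀ fun z => norm_ne_zero_iff.2 (hw0 z)).smul hw).subtype_mk _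
  refine ⟨ProjectiveSpace.mk ⟨_, hsph e he⟩, ⟨⟨⟨fun z => ProjectiveSpace.mk (k z),
    ProjectiveSpace.isQuotientMap_mk.continuous.comp hk⟩, ?_, ?_⟩⟩⟩
  · intro a
    refine Eq.trans ?_ (hrσ a)
    refine congrArg ProjectiveSpace.mk (Subtype.ext ?_)
    simp [k, w]
  · intro a
    refine congrArg ProjectiveSpace.mk (Subtype.ext ?_)
    simp [k, w]

end Projective

end NonlinearSpectrum

namespace Cheeger

/-! ### The Riemannian measure in charts and its total mass -/

section Volume

variable {n : ℕ} {M : Type*} [TopologicalSpace M] [ChartedSpace (Eucl n) M]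

theorem aemeasurable_extChartAt_symm [MeasurableSpace M] [BorelSpace M] (x₀ : M) :
    AEMeasurable (extChartAt (𝓡 n) x₀).symm
      ((volume : Measure (Eucl n)).restrict (extChartAt (𝓡 n) x₀).target) :=
  (continuousOn_extChartAt_symm x₀).aemeasurable (isOpen_extChartAt_target x₀).measurableSet

/-- The inverse chart is controlled only on its target; a constant value elsewhere makes it
measurable. -/
theorem measurableSet_target_inter_preimage [MeasurableSpace M] [BorelSpace M] (x₀ : M) {E : Set M} (hE : MeasurableSet E) :
    MeasurableSet ((extChartAt (𝓡 n) x₀).target ∩ (extChartAt (𝓡 n) x₀).symm ⁻¹' E) := by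
  classical
  have h := (continuousOn_extChartAt_symm (I := 𝓡 n) x₀).measurable_piecewise
    (g := fun _ => x₀) continuousOn_const (isOpen_extChartAt_target x₀).measurableSet
  convert (isOpen_extChartAt_target (I := 𝓡 n) x₀).measurableSet.inter (h hE) using 1
  ext y
  simp only [mem_inter_iff, mem_preimage]
  refine and_congr_right fun hy => ?_
  rw [piecewise_eq_of_mem _ _ _ hy]

variable [IsManifold (𝓡 n) ∞ M]

theorem aemeasurable_density (g : RiemMetric n M) (x₀ : M) :
    AEMeasurable (fun y => ENNReal.ofReal (density g x₀ y))
      ((volume : Measure (Eucl n)).restrict (extChartAt (𝓡 n) x₀).target) :=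
  (ContinuousOn.aemeasurable (fun _ hy => (contDiffAt_density g hy).continuousAt.continuousWithinAt)
    (isOpen_extChartAt_target x₀).measurableSet).ennreal_ofReal

/-- With `D` the derivative of the transition map, the Gram matrices are related by G₀ = Dᵀ G₁ D;
take determinants and square roots. -/
theorem density_change (g : RiemMetric n M) {x₀ x₁ : M} {y : Eucl n}
    (hy : y ∈ (extChartAt (𝓡 n) x₀).target)
    (hy1 : (extChartAt (𝓡 n) x₀).symm y ∈ (extChartAt (𝓡 n) x₁).source) :
    density g x₀ y = |(fderiv ℝ (extChartAt (𝓡 n) x₁ ∘ (extChartAt (𝓡 n) x₀).symm) y).det| *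
      density g x₁ ((extChartAt (𝓡 n) x₁ ∘ (extChartAt (𝓡 n) x₀).symm) y) := by
  have h := (frameMap_change hy hy1 g).2.2.1
  rw [density, density, metricMatrix_eq, metricMatrix_eq, h,
    LinearMap.toMatrix₂_compl₁₂ (EuclideanSpace.basisFun (Fin n) ℝ).toBasis
    (EuclideanSpace.basisFun (Fin n) ℝ).toBasis (EuclideanSpace.basisFun (Fin n) ℝ).toBasis
    (EuclideanSpace.basisFun (Fin n) ℝ).toBasis, Matrix.det_mul, Matrix.det_mul,
    Matrix.det_transpose, LinearMap.det_toMatrix, mul_right_comm, Real.sqrt_mul',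
    Real.sqrt_mul_self_eq_abs]
  rw [← metricMatrix_eq]
  exact (metricMatrix_posDef g ((extChartAt (𝓡 n) x₁).map_source hy1)).det_pos.le

variable [MeasurableSpace M] [BorelSpace M]

theorem chartVolume_apply (g : RiemMetric n M) (x₀ : M) {E : Set M} (hE : MeasurableSet E) :
    chartVolume g x₀ E = ∫⁻ y in (extChartAt (𝓡 n) x₀).target ∩ (extChartAt (𝓡 n) x₀).symm ⁻¹' E,
      ENNReal.ofReal (density g x₀ y) := by
  rw [chartVolume, Measure.map_apply_of_aemeasurable ((aemeasurable_extChartAt_symm x₀).mono_ac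
    (withDensity_absolutelyContinuous _ _)) hE, withDensity_apply',
    Measure.restrict_restrict' (isOpen_extChartAt_target x₀).measurableSet, inter_comm]

/-- The chart volumes agree on overlaps. -/
theorem chartVolume_eq (g : RiemMetric n M) {x₀ x₁ : M} {E : Set M} (hE : MeasurableSet E)
    (h0 : E ⊆ (extChartAt (𝓡 n) x₀).source) (h1 : E ⊆ (extChartAt (𝓡 n) x₁).source) :
    chartVolume g x₀ E = chartVolume g x₁ E := by
  rw [chartVolume_apply g x₀ hE, chartVolume_apply g x₁ hE]
  set s := (extChartAt (𝓡 n) x₀).target ∩ (extChartAt (𝓡 n) x₀).symm ⁻¹' E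
  set τ := extChartAt (𝓡 n) x₁ ∘ (extChartAt (𝓡 n) x₀).symm with hτ
  have himg : τ '' s = (extChartAt (𝓡 n) x₁).target ∩ (extChartAt (𝓡 n) x₁).symm ⁻¹' E := by
    ext z
    constructor
    · rintro ⟨y, ⟨hy, hyE⟩, rfl⟩
      refine ⟨(extChartAt (𝓡 n) x₁).map_source (h1 hyE), ?_⟩
      rw [mem_preimage, hτ, Function.comp, (extChartAt (𝓡 n) x₁).left_inv (h1 hyE)]
      exact hyE
    · rintro ⟨hz, hzE⟩
      have e : (extChartAt (𝓡 n) x₀).symm (extChartAt (𝓡 n) x₀ ((extChartAt (𝓡 n) x₁).symm z)) =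
        (extChartAt (𝓡 n) x₁).symm z := (extChartAt (𝓡 n) x₀).left_inv (h0 hzE)
      refine ⟨extChartAt (𝓡 n) x₀ ((extChartAt (𝓡 n) x₁).symm z),
        ⟨(extChartAt (𝓡 n) x₀).map_source (h0 hzE), ?_⟩, ?_⟩
      · rw [mem_preimage, e]
        exact hzE
      · rw [hτ, Function.comp, e, (extChartAt (𝓡 n) x₁).right_inv hz]
  have hd : ∀ y ∈ s, HasFDerivWithinAt τ (fderiv ℝ τ y) s y := fun y hy =>
    ((frameMap_change hy.1 (h1 hy.2) g).1.differentiableAt (by simp)).hasFDerivAt.hasFDerivWithinAt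
  have hinj : InjOn τ s := by
    intro y hy z hz hyz
    have := (extChartAt (𝓡 n) x₁).injOn (h1 hy.2) (h1 hz.2) hyz
    exact (extChartAt (𝓡 n) x₀).symm.injOn hy.1 hz.1 this
  -- Change of variables along the transition map; its Jacobian is the factor in `density_change`.
  rw [← himg, lintegral_image_eq_lintegral_abs_det_fderiv_mul _
    (measurableSet_target_inter_preimage x₀ hE) hd hinj]
  refine setLIntegral_congr_fun (measurableSet_target_inter_preimage x₀ hE) fun y hy => ?_
  rw [density_change g hy.1 (h1 hy.2), ENNReal.ofReal_mul (abs_nonneg _)]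

theorem chartVolume_inter_source (g : RiemMetric n M) (x₀ : M) {E : Set M} (hE : MeasurableSet E) :
    chartVolume g x₀ (E ∩ (extChartAt (𝓡 n) x₀).source) = chartVolume g x₀ E := by
  rw [chartVolume_apply g x₀ hE,
    chartVolume_apply g x₀ (hE.inter (isOpen_extChartAt_source x₀).measurableSet)]
  congr 2
  ext y
  simp only [mem_inter_iff, mem_preimage]
  exact ⟨fun h => ⟨h.1, h.2.1⟩, fun h => ⟨h.1, h.2, (extChartAt (𝓡 n) x₀).map_target h.1⟩⟩

/-- The measure of the chart at `x₀` sees only the part of `E` in its own domain, and there both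
chart measures agree. -/
theorem chartVolume_le (g : RiemMetric n M) {x₀ x₁ : M} {E : Set M} (hE : MeasurableSet E)
    (h1 : E ⊆ (extChartAt (𝓡 n) x₁).source) : chartVolume g x₀ E ≤ chartVolume g x₁ E := by
  rw [← chartVolume_inter_source g x₀ hE,
    chartVolume_eq g (hE.inter (isOpen_extChartAt_source x₀).measurableSet) inter_subset_right
      (inter_subset_left.trans h1)]
  exact measure_mono inter_subset_left

theorem riemannianVolume_apply (g : RiemMetric n M) {x₁ : M} {E : Set M} (hE : MeasurableSet E)
    (h1 : E ⊆ (extChartAt (𝓡 n) x₁).source) : riemannianVolume g E = chartVolume g x₁ E := by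
  refine le_antisymm ?_ (Measure.le_iff'.1 (le_iSup (chartVolume g) x₁) E)
  have hs : MeasurableSet (extChartAt (𝓡 n) x₁).source :=
    (isOpen_extChartAt_source x₁).measurableSet
  -- A supremum of measures is not computed set by set. This explicit upper bound of all chart
  -- measures, with the largest measure put outside the chart domain, bounds it on subsets of the
  -- domain.
  have hle : riemannianVolume g ≤ chartVolume g x₁ +
      (⊤ : Measure M).restrict (extChartAt (𝓡 n) x₁).sourceᶜ := by
    refine iSup_le fun x₀ => Measure.le_iff.2 fun F hF => ?_
    rw [← measure_inter_add_sdiff F hs, Measure.add_apply]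
    refine add_le_add ?_ ?_
    · exact (chartVolume_le g (hF.inter hs) inter_subset_right).trans (measure_mono inter_subset_left)
    · rw [Measure.restrict_apply hF]
      exact Measure.le_iff'.1 le_top _
  refine (Measure.le_iff'.1 hle E).trans_eq ?_
  rw [Measure.add_apply, Measure.restrict_apply hE, (disjoint_compl_right_iff_subset.2 h1).inter_eq,
    measure_empty, add_zero]

/-- On a chart domain the Riemannian measure is the measure of the chart. -/
theorem riemannianVolume_restrict (g : RiemMetric n M) (x₁ : M) :
    (riemannianVolume g).restrict (extChartAt (𝓡 n) x₁).source = chartVolume g x₁ := by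
  have hs : MeasurableSet (extChartAt (𝓡 n) x₁).source :=
    (isOpen_extChartAt_source x₁).measurableSet
  ext E hE
  rw [Measure.restrict_apply hE, riemannianVolume_apply g (hE.inter hs) inter_subset_right,
    chartVolume_inter_source g x₁ hE]

theorem integral_chartVolume (g : RiemMetric n M) (x₀ : M) {f : M → ℝ} (hf : Continuous f) :
    ∫ x, f x ∂(chartVolume g x₀) = ∫ y in (extChartAt (𝓡 n) x₀).target,
      density g x₀ y * f ((extChartAt (𝓡 n) x₀).symm y) := by
  rw [chartVolume, integral_map ((aemeasurable_extChartAt_symm x₀).mono_ac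
    (withDensity_absolutelyContinuous _ _)) hf.aestronglyMeasurable,
    integral_withDensity_eq_integral_toReal_smul₀ (aemeasurable_density g x₀)
      (Eventually.of_forall fun _ => ENNReal.ofReal_lt_top)]
  refine setIntegral_congr_fun (isOpen_extChartAt_target x₀).measurableSet fun y hy => ?_
  rw [ENNReal.toReal_ofReal (density_pos g hy).le, smul_eq_mul]

/-- The density is continuous, hence bounded on a small coordinate ball. On a compact manifold this
makes the total volume finite, as the normalization requires. -/
instance isLocallyFiniteMeasure_riemannianVolume (g : RiemMetric n M) :
    IsLocallyFiniteMeasure (riemannianVolume g) := by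
  refine ⟨fun x => ?_⟩
  set φ := extChartAt (𝓡 n) x
  have hx := mem_extChartAt_target (I := 𝓡 n) x
  have hev : ∀ᶠ y in 𝓝 (φ x), density g x y < density g x (φ x) + 1 :=
    (contDiffAt_density g hx).continuousAt.eventually_lt continuousAt_const (lt_add_one _)
  obtain ⟨ε, hε, hball⟩ := Metric.eventually_nhds_iff_ball.1 hev
  set V := φ.source ∩ φ ⁻¹' (Metric.ball (φ x) ε)
  have hV : IsOpen V := isOpen_extChartAt_preimage' x Metric.isOpen_ball
  refine ⟨V, hV.mem_nhds ⟨mem_extChartAt_source x, Metric.mem_ball_self hε⟩, ?_⟩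
  rw [riemannianVolume_apply g hV.measurableSet inter_subset_left,
    chartVolume_apply g x hV.measurableSet]
  have hsub : φ.target ∩ φ.symm ⁻¹' V ⊆ Metric.ball (φ x) ε := by
    rintro y ⟨hy, -, hyV⟩
    rwa [mem_preimage, φ.right_inv hy] at hyV
  calc ∫⁻ y in φ.target ∩ φ.symm ⁻¹' V, ENNReal.ofReal (density g x y)
      ≤ ∫⁻ y in φ.target ∩ φ.symm ⁻¹' V, ENNReal.ofReal (density g x (φ x) + 1) :=
        setLIntegral_mono measurable_const fun y hy =>
          ENNReal.ofReal_le_ofReal (hball y (hsub hy)).le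
    _ = ENNReal.ofReal (density g x (φ x) + 1) * volume (φ.target ∩ φ.symm ⁻¹' V) :=
        setLIntegral_const _ _
    _ < ⊤ := ENNReal.mul_lt_top ENNReal.ofReal_lt_top
        ((measure_mono hsub).trans_lt measure_ball_lt_top)

/-- A single chart suffices: its density is positive on a nonempty open set. -/
theorem riemannianVolume_univ_ne_zero [Nonempty M] (g : RiemMetric n M) :
    riemannianVolume g univ ≠ 0 := by
  obtain ⟨x⟩ := ‹Nonempty M›
  have hs : MeasurableSet (extChartAt (𝓡 n) x).target :=
    (isOpen_extChartAt_target x).measurableSet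
  have h0 : chartVolume g x univ ≠ 0 := by
    rw [chartVolume_apply g x MeasurableSet.univ, preimage_univ, inter_univ, Ne,
      lintegral_eq_zero_iff' (aemeasurable_density g x)]
    intro h
    have h2 : ∀ᵐ y ∂(volume : Measure (Eucl n)).restrict (extChartAt (𝓡 n) x).target, False := by
      filter_upwards [h, ae_restrict_mem hs] with y hy hyt
      exact absurd (ENNReal.ofReal_eq_zero.1 hy) (not_le.2 (density_pos g hyt))
    rw [eventually_false_iff_eq_bot, ae_eq_bot, Measure.restrict_eq_zero] at h2
    exact ((isOpen_extChartAt_target x).measure_pos volume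
      ⟨_, mem_extChartAt_target (I := 𝓡 n) x⟩).ne' h2
  exact fun h => h0 (le_antisymm ((Measure.le_iff'.1 (le_iSup (chartVolume g) x) univ).trans h.le)
    bot_le)

instance isProbabilityMeasure_normalizedVolume [CompactSpace M] [Nonempty M] (g : RiemMetric n M) :
    IsProbabilityMeasure (normalizedVolume g) := by
  refine ⟨?_⟩
  rw [normalizedVolume, Measure.smul_apply, smul_eq_mul]
  exact ENNReal.inv_mul_cancel (riemannianVolume_univ_ne_zero g) isCompact_univ.measure_lt_top.ne

end Volume

end Cheeger

namespace Cheeger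

/-! ### The divergence theorem -/

section DivergenceTheorem

/-- Integration by parts against the constant function 1. -/
theorem integral_fderiv_apply_eq_zero {n : ℕ} {W : Eucl n → Eucl n} (hW : ContDiff ℝ 1 W)
    (hc : HasCompactSupport W) (v : Eucl n) (i : Fin n) :
    Integrable (fun y => fderiv ℝ W y v i) ∧ ∫ y, fderiv ℝ W y v i = 0 := by
  let f : Eucl n → ℝ := fun y => W y i
  have hf : ContDiff ℝ 1 f := (EuclideanSpace.proj (𝕜 := ℝ) i).contDiff.comp hW
  have hfc : HasCompactSupport f := hc.comp_left (g := fun w : Eucl n => w i) rfl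
  have hfd : ∀ y, fderiv ℝ f y v = fderiv ℝ W y v i := by
    intro y
    have h : HasFDerivAt f ((EuclideanSpace.proj (𝕜 := ℝ) i) ∘L fderiv ℝ W y) y :=
      (EuclideanSpace.proj (𝕜 := ℝ) i).hasFDerivAt.comp y
        (hW.differentiable (by simp) y).hasFDerivAt
    rw [h.fderiv]
    rfl
  have hcont : Continuous fun y => fderiv ℝ f y v :=
    (hf.continuous_fderiv (by simp)).clm_apply continuous_const
  have hint : Integrable fun y => fderiv ℝ f y v :=
    hcont.integrable_of_hasCompactSupport (hfc.fderiv_apply ℝ v)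
  have h := integral_mul_fderiv_eq_neg_fderiv_mul_of_integrable (μ := (volume : Measure (Eucl n)))
    (f := fun _ : Eucl n => (1 : ℝ)) (g := f) (v := v) (by simp)
    (by simpa using hint) (by simpa using hf.continuous.integrable_of_hasCompactSupport hfc)
    (fun _ _ => differentiableAt_const _) (fun y _ => hf.differentiable (by simp) y)
  simp only [one_mul, fderiv_fun_const, Pi.zero_apply, zero_apply, zero_mul,
    integral_zero, neg_zero] at h
  simp only [hfd] at h hint
  exact ⟨hint, h⟩

variable {n : ℕ} {M : Type*} [TopologicalSpace M] [ChartedSpace (Eucl n) M]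

theorem coordField_eq_zero {X : ∀ x : M, TangentSpace (𝓡 n) x} {x₀ : M} {y : Eucl n}
    (h : X ((extChartAt (𝓡 n) x₀).symm y) = 0) : coordField X x₀ y = 0 := by
  change (mfderiv 𝓘(ℝ, Eucl n) (𝓡 n) (extChartAt (𝓡 n) x₀).symm y).inverse
    (X ((extChartAt (𝓡 n) x₀).symm y)) = 0
  rw [h, map_zero]

variable [IsManifold (𝓡 n) ∞ M]

theorem differentiableAt_density_smul_coordField (g : RiemMetric n M)
    {X : ∀ x : M, TangentSpace (𝓡 n) x} (hX : IsSmoothField X) {x₀ : M} {y : Eucl n}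
    (hy : y ∈ (extChartAt (𝓡 n) x₀).target) :
    DifferentiableAt ℝ (fun z => density g x₀ z • coordField X x₀ z) y :=
  ((contDiffAt_density g hy).smul (contDiffAt_coordField hX hy)).differentiableAt (by simp)

theorem divergence_eq_zero_of_eventuallyEq (g : RiemMetric n M)
    {X : ∀ x : M, TangentSpace (𝓡 n) x} {x : M} (h : ∀ᶠ z in 𝓝 x, X z = 0) :
    divergence g X x = 0 := by
  have hx := mem_extChartAt_target (I := 𝓡 n) x
  have hc : Tendsto (extChartAt (𝓡 n) x).symm (𝓝 (extChartAt (𝓡 n) x x)) (𝓝 x) := by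
    simpa only [extChartAt_to_inv] using (contMDiffAt_symm hx).continuousAt.tendsto
  have h0 : (fun z => density g x z • coordField X x z) =ᶠ[𝓝 (extChartAt (𝓡 n) x x)]
      fun _ => (0 : Eucl n) := by
    filter_upwards [hc.eventually h] with z hz
    rw [coordField_eq_zero hz, smul_zero]
  rw [divergence, chartDivergence, h0.fderiv_eq]
  simp

theorem divergence_add (g : RiemMetric n M) {X Y : ∀ x : M, TangentSpace (𝓡 n) x}
    (hX : IsSmoothField X) (hY : IsSmoothField Y) (x : M) :
    divergence g (X + Y) x = divergence g X x + divergence g Y x := by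
  have hx := mem_extChartAt_target (I := 𝓡 n) x
  have h : (fun z => density g x z • coordField (X + Y) x z) =
      fun z => density g x z • coordField X x z + density g x z • coordField Y x z := by
    ext1 z
    rw [← smul_add]
    congr 1
    exact VectorField.mpullback_add_apply
  rw [divergence, chartDivergence, h, fderiv_fun_add
    (differentiableAt_density_smul_coordField g hX hx)
    (differentiableAt_density_smul_coordField g hY hx)]
  simp only [divergence, chartDivergence, add_apply, PiLp.add_apply, Finset.sum_add_distrib,
    mul_add]

theorem divergence_sum (g : RiemMetric n M) {ι : Type*} (s : Finset ι)
    {X : ι → ∀ x : M, TangentSpace (𝓡 n) x} (hX : ∀ i, IsSmoothField (X i)) (x : M) :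
    divergence g (fun z => ∑ i ∈ s, X i z) x = ∑ i ∈ s, divergence g (X i) x := by
  classical
  induction s using Finset.induction_on with
  | empty => exact divergence_eq_zero_of_eventuallyEq g (Eventually.of_forall fun z => by simp)
  | insert i s hi ih =>
    have h : (fun z => ∑ j ∈ insert i s, X j z) = X i + fun z => ∑ j ∈ s, X j z := by
      ext1 z
      rw [Finset.sum_insert hi, Pi.add_apply]
    rw [h, divergence_add g (hX i) (ContMDiff.sum_section fun j _ => hX j), ih,
      Finset.sum_insert hi]

variable [MeasurableSpace M] [BorelSpace M]

/-- In the chart, density times divergence is the Euclidean divergence of density times field.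
Extended by zero, that product is a compactly supported C¹ field on `ℝ^n`. -/
theorem integral_divergence_of_subset_source [T2Space M] (g : RiemMetric n M)
    {X : ∀ x : M, TangentSpace (𝓡 n) x} (hX : IsSmoothField X) {x₀ : M} {K : Set M}
    (hK : IsCompact K) (hKs : K ⊆ (extChartAt (𝓡 n) x₀).source) (hXK : ∀ x, x ∉ K → X x = 0) :
    ∫ x, divergence g X x ∂(riemannianVolume g) = 0 := by
  classical
  set φ := extChartAt (𝓡 n) x₀
  have ht : MeasurableSet φ.target := (isOpen_extChartAt_target x₀).measurableSet
  let V : Eucl n → Eucl n := fun y => density g x₀ y • coordField X x₀ y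
  let W : Eucl n → Eucl n := φ.target.indicator V
  have hKc : IsCompact (φ '' K) := hK.image_of_continuousOn ((continuousOn_extChartAt x₀).mono hKs)
  have hW0 : ∀ y, y ∉ φ '' K → W y = 0 := by
    intro y hy
    by_cases hyt : y ∈ φ.target
    · have : φ.symm y ∉ K := fun h => hy ⟨_, h, φ.right_inv hyt⟩
      refine (indicator_of_mem hyt V).trans ?_
      change density g x₀ y • coordField X x₀ y = 0
      rw [coordField_eq_zero (hXK _ this), smul_zero]
    · exact indicator_of_notMem hyt _
  have hWV : ∀ y ∈ φ.target, W =ᶠ[𝓝 y] V := by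
    intro y hy
    filter_upwards [(isOpen_extChartAt_target x₀).mem_nhds hy] with z hz
    exact indicator_of_mem hz _
  -- The image of `K` is compact, hence closed, and lies in the target. So the extension by zero is
  -- smooth also at boundary points of the target.
  have hWz : ∀ y ∉ φ.target, W =ᶠ[𝓝 y] fun _ => 0 := by
    intro y hy
    have : y ∉ φ '' K := by
      rintro ⟨x, hx, rfl⟩
      exact hy (φ.map_source (hKs hx))
    filter_upwards [hKc.isClosed.isOpen_compl.mem_nhds this] with z hz
    exact hW0 z hz
  have hWs : ContDiff ℝ 1 W := by
    rw [contDiff_iff_contDiffAt]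
    intro y
    by_cases hy : y ∈ φ.target
    · have hV : ContDiffAt ℝ ∞ V y := (contDiffAt_density g hy).smul (contDiffAt_coordField hX hy)
      exact (hV.of_le (by norm_cast)).congr_of_eventuallyEq (hWV y hy)
    · exact contDiffAt_const.congr_of_eventuallyEq (hWz y hy)
  have hWc : HasCompactSupport W := HasCompactSupport.intro hKc hW0
  have hdiv0 : ∀ x, x ∉ φ.source → divergence g X x = 0 := by
    intro x hx
    refine divergence_eq_zero_of_eventuallyEq g ?_
    filter_upwards [hK.isClosed.isOpen_compl.mem_nhds fun h => hx (hKs h)] with z hz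
    exact hXK z hz
  rw [← setIntegral_eq_integral_of_forall_compl_eq_zero hdiv0, riemannianVolume_restrict,
    integral_chartVolume g x₀ (continuous_divergence g hX)]
  have h1 : ∫ y in φ.target, density g x₀ y * divergence g X (φ.symm y) =
      ∫ y in φ.target, ∑ i, fderiv ℝ W y (EuclideanSpace.single i 1) i := by
    refine setIntegral_congr_fun ht fun y hy => ?_
    have e : divergence g X (φ.symm y) = chartDivergence g X x₀ y := by
      have := chartDivergence_eq g hX (mem_extChartAt_source (I := 𝓡 n) (φ.symm y))
        (φ.map_target hy)
      rw [φ.right_inv hy] at this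
      exact this
    rw [e, chartDivergence, mul_inv_cancel_left₀ (density_pos g hy).ne', (hWV y hy).fderiv_eq]
  rw [h1, setIntegral_eq_integral_of_forall_compl_eq_zero, integral_finsetSum]
  · exact Finset.sum_eq_zero fun i _ => (integral_fderiv_apply_eq_zero hWs hWc _ i).2
  · exact fun i _ => (integral_fderiv_apply_eq_zero hWs hWc _ i).1
  · intro y hy
    rw [(hWz y hy).fderiv_eq]
    simp

/-- The divergence theorem on a closed manifold. -/
theorem integral_divergence [T2Space M] [CompactSpace M] (g : RiemMetric n M)
    {X : ∀ x : M, TangentSpace (𝓡 n) x} (hX : IsSmoothField X) :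
    ∫ x, divergence g X x ∂(riemannianVolume g) = 0 := by
  obtain ⟨t, ht⟩ := isCompact_univ.elim_finite_subcover (fun x : M => (extChartAt (𝓡 n) x).source)
    (fun x => isOpen_extChartAt_source x) fun x _ => mem_iUnion.2 ⟨x, mem_extChartAt_source x⟩
  -- Finitely many charts make the field a finite sum of pieces, each supported in one chart domain.
  obtain ⟨ρ, hρ⟩ := SmoothPartitionOfUnity.exists_isSubordinate (𝓡 n) isClosed_univ
    (fun x : t => (extChartAt (𝓡 n) (x : M)).source) (fun x => isOpen_extChartAt_source (x : M))
    (fun x hx => by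
      obtain ⟨i, hi, hxi⟩ := mem_iUnion₂.1 (ht hx)
      exact mem_iUnion.2 ⟨⟨i, hi⟩, hxi⟩)
  let Y : t → ∀ x : M, TangentSpace (𝓡 n) x := fun i => (ρ i : M → ℝ) • X
  have hY : ∀ i, IsSmoothField (Y i) := fun i => ContMDiff.smul_section (ρ i).contMDiff hX
  have hXY : X = fun z => ∑ i, Y i z := by
    ext1 z
    have h1 : ∑ i, ρ i z = 1 := by
      rw [← finsum_eq_sum_of_fintype]
      exact ρ.sum_eq_one (mem_univ z)
    change X z = ∑ i, ρ i z • X z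
    rw [← Finset.sum_smul, h1, one_smul]
  have hd : ∀ x, divergence g X x = ∑ i, divergence g (Y i) x := by
    intro x
    conv_lhs => rw [hXY]
    exact divergence_sum g _ hY x
  simp only [hd]
  rw [integral_finsetSum]
  · refine Finset.sum_eq_zero fun i _ => ?_
    refine integral_divergence_of_subset_source g (hY i) (isClosed_tsupport (ρ i)).isCompact (hρ i)
      fun x hx => ?_
    change ρ i x • X x = 0
    rw [image_eq_zero_of_notMem_tsupport hx, zero_smul]
  · exact fun i _ => (continuous_divergence g (hY i)).integrable_of_hasCompactSupport
      (HasCompactSupport.of_compactSpace _)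

theorem integral_divergence_normalizedVolume [T2Space M] [CompactSpace M] (g : RiemMetric n M)
    {X : ∀ x : M, TangentSpace (𝓡 n) x} (hX : IsSmoothField X) :
    ∫ x, divergence g X x ∂(normalizedVolume g) = 0 := by
  rw [normalizedVolume, integral_smul_measure, integral_divergence g hX, smul_zero]

end DivergenceTheorem

end Cheeger

namespace Cheeger

/-! ### Medians and the measure of the positivity set -/

section Median

variable {Ω : Type*} [MeasurableSpace Ω] {μ : Measure Ω}

theorem IsMedian.congr {u v : Ω → ℝ} {m : ℝ} (h : IsMedian μ u m) (huv : u =ᵐ[μ] v) :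
    IsMedian μ v m := by
  have h1 : μ {x | u x ≤ m} = μ {x | v x ≤ m} := measure_congr (by
    filter_upwards [huv] with x hx
    exact congrArg (· ≤ m) hx)
  have h2 : μ {x | m ≤ u x} = μ {x | m ≤ v x} := measure_congr (by
    filter_upwards [huv] with x hx
    exact congrArg (m ≤ ·) hx)
  exact ⟨h1 ▸ h.1, h2 ▸ h.2⟩

theorem IsMedian.const_mul_zero {u : Ω → ℝ} (h : IsMedian μ u 0) {c : ℝ} (hc : 0 < c) :
    IsMedian μ (fun x => c * u x) 0 := by
  have h1 : ∀ x, c * u x ≤ 0 ↔ u x ≤ 0 := fun x => by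
    rw [← neg_nonneg, ← mul_neg, mul_nonneg_iff_of_pos_left hc, neg_nonneg]
  simpa only [IsMedian, mul_nonneg_iff_of_pos_left hc, h1] using h

/-- The measure of the positivity set is lower semicontinuous on `L¹`. -/
theorem isOpen_lt_measure_pos (c : ℝ≥0∞) : IsOpen {u : Lp ℝ 1 μ | c < μ {x | 0 < u x}} := by
  rw [isOpen_iff_mem_nhds]
  intro u hu
  -- These sets exhaust {u > 0}, so by continuity from below one of them already has measure above
  -- `c`.
  have hmono : Monotone fun k : ℕ => {x | 1 / ((k : ℝ) + 1) ≤ u x} := by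
    intro j k hjk x hx
    have hx' : 1 / ((j : ℝ) + 1) ≤ u x := hx
    exact (Nat.one_div_le_one_div hjk).trans hx'
  have hU : {x | 0 < u x} = ⋃ k : ℕ, {x | 1 / ((k : ℝ) + 1) ≤ u x} := by
    ext x
    simp only [mem_ofPred_eq, mem_iUnion]
    constructor
    · intro h
      obtain ⟨k, hk⟩ := exists_nat_one_div_lt h
      exact ⟨k, hk.le⟩
    · rintro ⟨k, hk⟩
      exact Nat.one_div_pos_of_nat.trans_le hk
  have ht := tendsto_measure_iUnion_atTop (μ := μ) hmono
  rw [← hU] at ht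
  obtain ⟨k, hk⟩ := (ht.eventually (lt_mem_nhds hu)).exists
  set ε : ℝ := 1 / ((k : ℝ) + 1)
  have hε : 0 < ε := Nat.one_div_pos_of_nat
  -- L¹ convergence implies convergence in measure. A point with `u ≥ ε` and `v ≤ 0` has |v - u| ≥
  -- ε, so for `v` near `u` few points leave the positivity set.
  have hm := tendstoInMeasure_of_tendsto_Lp (μ := μ) (f := fun v : Lp ℝ 1 μ => v) (g := u)
    tendsto_id (ENNReal.ofReal ε) (ENNReal.ofReal_pos.2 hε)
  filter_upwards [hm.eventually (gt_mem_nhds (tsub_pos_of_lt hk))] with v hv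
  rw [lt_tsub_iff_left] at hv
  by_contra hcon
  refine absurd hv (not_lt.2 ?_)
  have hsub : {x | ε ≤ u x} ⊆ {x | 0 < v x} ∪ {x | ENNReal.ofReal ε ≤ edist (v x) (u x)} := by
    intro x hx
    by_cases h0 : 0 < v x
    · exact Or.inl h0
    · right
      have hx' : ε ≤ u x := hx
      rw [mem_ofPred, edist_dist, Real.dist_eq]
      refine ENNReal.ofReal_le_ofReal ?_
      rw [abs_sub_comm]
      exact (by linarith : ε ≤ u x - v x).trans (le_abs_self _)
  refine (measure_mono hsub).trans ((measure_union_le _ _).trans ?_)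
  gcongr
  exact not_lt.1 hcon

variable [IsProbabilityMeasure μ]

/-- Adding `c` raises |u| by exactly `c` on {u ≥ 0}, at least half of the space, and lowers it by at
most `c` elsewhere. -/
theorem integral_abs_le_integral_abs_add_of_nonneg {u : Ω → ℝ} (hu : Integrable u μ)
    (h : 1 / 2 ≤ μ {x | 0 ≤ u x}) {c : ℝ} (hc : 0 ≤ c) :
    ∫ x, |u x| ∂μ ≤ ∫ x, |u x + c| ∂μ := by
  set E := {x | 0 ≤ u x}
  have hE : NullMeasurableSet E μ := nullMeasurableSet_le aemeasurable_const hu.aemeasurable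
  have hreal : 1 / 2 ≤ μ.real E := by
    have := ENNReal.toReal_mono (measure_ne_top μ E) h
    simpa [measureReal_def] using this
  have hind : Integrable (E.indicator fun _ => 2 * c) μ := (integrable_const _).indicator₀ hE
  have hpt : ∀ x, |u x| + (E.indicator (fun _ => 2 * c) x - c) ≤ |u x + c| := by
    intro x
    by_cases hx : x ∈ E
    · have hx' : 0 ≤ u x := hx
      rw [indicator_of_mem hx, abs_of_nonneg hx', abs_of_nonneg (by linarith)]
      linarith
    · rw [indicator_of_notMem hx]
      have := abs_sub_abs_le_abs_sub (u x) (-c)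
      rw [abs_neg, abs_of_nonneg hc, sub_neg_eq_add] at this
      linarith
  have h1 : ∫ x, (|u x| + (E.indicator (fun _ => 2 * c) x - c)) ∂μ ≤ ∫ x, |u x + c| ∂μ :=
    integral_mono (hu.abs.add (hind.sub (integrable_const c)))
      (hu.add (integrable_const c)).abs hpt
  have h2 : ∫ x, (E.indicator (fun _ => 2 * c) x - c) ∂μ = μ.real E * (2 * c) - c := by
    rw [integral_sub hind (integrable_const c), integral_indicator₀ hE, setIntegral_const]
    simp
  have h3 : ∫ x, (|u x| + (E.indicator (fun _ => 2 * c) x - c)) ∂μ =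
      ∫ x, |u x| ∂μ + ∫ x, (E.indicator (fun _ => 2 * c) x - c) ∂μ :=
    integral_add hu.abs (hind.sub (integrable_const c))
  rw [h3, h2] at h1
  nlinarith

/-- A median minimizes the `L¹` distance to the constants. -/
theorem IsMedian.integral_abs_le {u : Ω → ℝ} (h : IsMedian μ u 0) (hu : Integrable u μ) (c : ℝ) :
    ∫ x, |u x| ∂μ ≤ ∫ x, |u x + c| ∂μ := by
  rcases le_total 0 c with hc | hc
  · exact integral_abs_le_integral_abs_add_of_nonneg hu h.2 hc
  · have h1 := integral_abs_le_integral_abs_add_of_nonneg (u := fun x => -u x) hu.neg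
      (by simpa using h.1) (neg_nonneg.2 hc)
    simpa only [← neg_add, abs_neg] using h1

theorem half_lt_measure_compl {E : Set Ω} (hE : NullMeasurableSet E μ) (h : μ E < 1 / 2) :
    1 / 2 < μ Eᶜ := by
  rw [prob_compl_eq_one_sub₀ hE, lt_tsub_iff_left]
  calc μ E + 1 / 2 < 1 / 2 + 1 / 2 := ENNReal.add_lt_add_right (by simp) h
    _ = 1 := ENNReal.add_halves 1

/-- The inequalities come out strict, which is the form that defines an open set of functions. -/
theorem half_lt_measure_of_not_isMedian {u : Ω → ℝ} (hu : AEMeasurable u μ)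
    (h : ¬ IsMedian μ u 0) : 1 / 2 < μ {x | 0 < u x} ∨ 1 / 2 < μ {x | u x < 0} := by
  rw [IsMedian, not_and_or, not_le, not_le] at h
  refine h.imp (fun h => ?_) fun h => ?_
  · convert half_lt_measure_compl (nullMeasurableSet_le hu aemeasurable_const) h using 2
    ext x
    simp
  · convert half_lt_measure_compl (nullMeasurableSet_le aemeasurable_const hu) h using 2
    ext x
    simp

/-- Ensures that `u` and `-u` are not both positive on more than half of the space. -/
theorem measure_pos_add_measure_neg_le_one {u : Ω → ℝ} (hu : AEMeasurable u μ) :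
    μ {x | 0 < u x} + μ {x | u x < 0} ≤ 1 := by
  rw [← measure_union₀ (nullMeasurableSet_lt hu aemeasurable_const)]
  · exact prob_le_one
  · refine Disjoint.aedisjoint (disjoint_left.2 fun x h1 h2 => ?_)
    exact lt_asymm (mem_ofPred.1 h1) h2

end Median

/-! ### The two comparisons with the Cheeger constant -/

section Eigenvalue

variable {n : ℕ} {M : Type*} [TopologicalSpace M] [ChartedSpace (Eucl n) M] [IsManifold (𝓡 n) ∞ M]
  [MeasurableSpace M] [BorelSpace M] [CompactSpace M]

section

variable {g : RiemMetric n M}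

theorem energy_eq (u : BV g) : energy u = u.tv / ‖u.toL1‖ := by
  rw [energy, L1.norm_eq_integral_norm]
  rfl

/-- Carries open conditions in L¹ over to the sphere of `BV g`. -/
theorem BV.continuous_toL1 : Continuous (BV.toL1 : BV g → L1 g) :=
  AddMonoidHomClass.continuous_of_bound BV.toL1 1 fun u => by
    rw [one_mul, BV.norm_def]
    exact le_add_of_nonneg_left ENNReal.toReal_nonneg

theorem BV.tv_nonneg (u : BV g) : 0 ≤ u.tv := ENNReal.toReal_nonneg

theorem BV.toL1_injective : Function.Injective (BV.toL1 : BV g → L1 g) := Subtype.val_injective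

theorem BV.norm_toL1_pos {u : BV g} (hu : u ≠ 0) : 0 < ‖u.toL1‖ :=
  norm_pos_iff.2 ((map_ne_zero_iff _ BV.toL1_injective).2 hu)

theorem BV.coeFn_smul (c : ℝ) (u : BV g) :
    (c • u).toL1 =ᵐ[normalizedVolume g] fun x => c * u.toL1 x := by
  rw [map_smul]
  filter_upwards [Lp.coeFn_smul c u.toL1] with x hx
  rw [hx, Pi.smul_apply, smul_eq_mul]

/-- Points of the sphere have BV norm 1, not L¹ norm 1. Dividing by `‖u‖₁` keeps the median 0 and
turns the energy into the total variation. -/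
theorem cheegerConstant_le_energy {u : BV g} (hu : u ≠ 0)
    (hm : IsMedian (normalizedVolume g) u.toL1 0) : cheegerConstant g ≤ (energy u : EReal) := by
  have hpos := BV.norm_toL1_pos hu
  refine (iInf₂_le (‖u.toL1‖⁻¹ • u) (And.intro ?_ ?_)).trans_eq ?_
  · rw [map_smul, norm_smul, norm_inv, norm_norm, inv_mul_cancel₀ hpos.ne']
  · exact (hm.const_mul_zero (inv_pos.2 hpos)).congr (BV.coeFn_smul _ u).symm
  · rw [BV.tv_smul, abs_of_pos (inv_pos.2 hpos), energy_eq, inv_mul_eq_div]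

variable [T2Space M] [Nonempty M]

theorem totalVariation_const (c : ℝ) :
    totalVariation g (Lp.const 1 (normalizedVolume g) c) = 0 := by
  simp only [totalVariation, ENNReal.iSup_eq_zero]
  intro X hX
  have h : ∫ x, (Lp.const 1 (normalizedVolume g) c) x * divergence g X x ∂(normalizedVolume g) =
      ∫ x, c * divergence g X x ∂(normalizedVolume g) := by
    refine integral_congr_ae ?_
    filter_upwards [Lp.coeFn_const 1 (normalizedVolume g) c] with x hx
    rw [hx, Function.const_apply]
  rw [h, integral_const_mul, integral_divergence_normalizedVolume g hX.1, mul_zero,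
    ENNReal.ofReal_zero]

variable (g) in
/-- The constant function `1` as a function of bounded variation. -/
noncomputable def BV.one : BV g := ⟨Lp.const 1 (normalizedVolume g) 1, by
  change totalVariation g _ < ⊤
  rw [totalVariation_const]
  exact ENNReal.zero_lt_top⟩

theorem BV.toL1_one : (BV.one g).toL1 = Lp.const 1 (normalizedVolume g) 1 := rfl

theorem BV.coeFn_one : (BV.one g).toL1 =ᵐ[normalizedVolume g] fun _ => 1 :=
  Lp.coeFn_const 1 (normalizedVolume g) (1 : ℝ)

theorem BV.tv_one : (BV.one g).tv = 0 := by
  rw [BV.tv, BV.toL1_one, totalVariation_const, ENNReal.toReal_zero]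

theorem BV.coeFn_smul_add_smul_one (a b : ℝ) (u : BV g) :
    (a • u + b • BV.one g).toL1 =ᵐ[normalizedVolume g] fun x => a * u.toL1 x + b := by
  rw [map_add]
  filter_upwards [Lp.coeFn_add (a • u).toL1 (b • BV.one g).toL1, BV.coeFn_smul a u,
    BV.coeFn_smul b (BV.one g), BV.coeFn_one (g := g)] with x h1 h2 h3 h4
  rw [h1, Pi.add_apply, h2, h3, h4, mul_one]

/-- Factor out `a` and use that the median 0 minimizes the distance from `u` to the constant `-b /
a`. -/
theorem BV.abs_mul_norm_le {u : BV g} (hm : IsMedian (normalizedVolume g) u.toL1 0) (a b : ℝ) :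
    |a| * ‖u.toL1‖ ≤ ‖(a • u + b • BV.one g).toL1‖ := by
  rcases eq_or_ne a 0 with rfl | ha
  · simp
  have h1 : ‖(a • u + b • BV.one g).toL1‖ =
      |a| * ∫ x, |u.toL1 x + b / a| ∂(normalizedVolume g) := by
    rw [L1.norm_eq_integral_norm, ← integral_const_mul]
    refine integral_congr_ae ?_
    filter_upwards [BV.coeFn_smul_add_smul_one a b u] with x hx
    rw [hx, Real.norm_eq_abs, ← abs_mul, mul_add, mul_div_cancel₀ _ ha]
  rw [h1, L1.norm_eq_integral_norm]
  exact mul_le_mul_of_nonneg_left (hm.integral_abs_le (L1.integrable_coeFn _) _) (abs_nonneg a)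

theorem BV.energy_smul_add_smul_one_le {u : BV g} (hu : ‖u.toL1‖ = 1)
    (hm : IsMedian (normalizedVolume g) u.toL1 0) (a b : ℝ) :
    energy (a • u + b • BV.one g) ≤ u.tv := by
  rw [energy_eq]
  -- A nonnegative denominator suffices here, so the zero vector needs no separate case.
  refine div_le_of_le_mul₀ (norm_nonneg _) u.tv_nonneg ?_
  have h1 := BV.tv_add_le (a • u) (b • BV.one g)
  rw [BV.tv_smul, BV.tv_smul, BV.tv_one, mul_zero, add_zero] at h1
  have h2 := BV.abs_mul_norm_le hm a b
  rw [hu, mul_one] at h2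
  rw [mul_comm]
  exact h1.trans (mul_le_mul_of_nonneg_right h2 u.tv_nonneg)

/-- `BV.abs_mul_norm_le` applied to a vanishing combination kills `a`; then `b = 0` almost
everywhere, for a nonzero measure. -/
theorem BV.linearIndependent_one {u : BV g} (hu : ‖u.toL1‖ = 1)
    (hm : IsMedian (normalizedVolume g) u.toL1 0) : LinearIndependent ℝ ![u, BV.one g] := by
  refine LinearIndependent.pair_iff.2 fun a b hab => ?_
  have h := BV.abs_mul_norm_le hm a b
  rw [hab, hu, map_zero, norm_zero, mul_one] at h
  have ha : a = 0 := abs_nonpos_iff.1 h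
  refine ⟨ha, ?_⟩
  have h1 := BV.coeFn_smul_add_smul_one a b u
  rw [hab, map_zero] at h1
  have h2 : ∀ᵐ _ ∂(normalizedVolume g), b = 0 := by
    filter_upwards [h1, Lp.coeFn_zero ℝ 1 (normalizedVolume g)] with x hx h0
    rw [h0, ha, zero_mul, zero_add] at hx
    exact hx.symm
  obtain ⟨_, hb⟩ := h2.exists
  exact hb

end

variable [T2Space M] [Nonempty M]

theorem kr_le_cheegerConstant (g : RiemMetric n M) :
    NonlinearSpectrum.kr (sphereEnergy g) 2 ≤ cheegerConstant g := by
  refine le_iInf₂ fun u hu => ?_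
  obtain ⟨hu, hm⟩ := hu
  refine (iInf₂_le ((Submodule.span ℝ {u, BV.one g} : Set (BV g)) ∩ Metric.sphere 0 1)
    (And.intro inter_subset_right (And.intro ?_ (And.intro ?_ ?_)))).trans ?_
  · have : FiniteDimensional ℝ (Submodule.span ℝ {u, BV.one g}) :=
      FiniteDimensional.span_of_finite ℝ (toFinite _)
    exact (Submodule.closed_of_finiteDimensional _).inter Metric.isClosed_sphere
  · exact fun x hx => ⟨Submodule.neg_mem _ hx.1, by simpa using hx.2⟩
  · exact NonlinearSpectrum.two_le_genus_of_plane (BV.linearIndependent_one hu hm)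
  · refine iSup₂_le fun x hx => ?_
    obtain ⟨a, b, hab⟩ := Submodule.mem_span_pair.1 hx.1
    rw [sphereEnergy, ← hab]
    exact_mod_cast BV.energy_smul_add_smul_one_le hu hm a b

theorem cheegerConstant_le_hs (g : RiemMetric n M) :
    cheegerConstant g ≤ NonlinearSpectrum.hs (projectiveEnergy g) 2 := by
  refine le_iInf₂ fun A hA => ?_
  obtain ⟨hcl, h2⟩ := hA
  suffices h : ∃ x : Metric.sphere (0 : BV g) 1, NonlinearSpectrum.ProjectiveSpace.mk x ∈ A ∧
      IsMedian (normalizedVolume g) (x : BV g).toL1 0 by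
    obtain ⟨x, hxA, hm⟩ := h
    refine (cheegerConstant_le_energy (ne_zero_of_mem_unit_sphere x) hm).trans ?_
    exact le_iSup₂ (f := fun (y : NonlinearSpectrum.ProjectiveSpace (BV g)) (_ : y ∈ A) =>
      (projectiveEnergy g y : EReal)) _ hxA
  by_contra! hcon
  have hae : ∀ u : BV g, AEMeasurable u.toL1 (normalizedVolume g) := fun u =>
    (L1.integrable_coeFn u.toL1).aemeasurable
  have hneg : ∀ u : BV g, normalizedVolume g {x | 0 < (-u).toL1 x} =
      normalizedVolume g {x | u.toL1 x < 0} := by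
    intro u
    refine measure_congr ?_
    rw [map_neg]
    filter_upwards [Lp.coeFn_neg u.toL1] with x hx
    refine propext ?_
    change 0 < (-u.toL1 : L1 g) x ↔ u.toL1 x < 0
    rw [hx, Pi.neg_apply, neg_pos]
  -- The preferred representatives: if no class in `A` has median 0, exactly one of `x` and `-x`
  -- lies in `U`.
  let U : Set (Metric.sphere (0 : BV g) 1) :=
    {x | 1 / 2 < normalizedVolume g {p | 0 < (x : BV g).toL1 p}}
  have hU : IsOpen U := (isOpen_lt_measure_pos (1 / 2)).preimage
    (BV.continuous_toL1.comp continuous_subtype_val)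
  have hcat : NonlinearSpectrum.category A ≤ 1 := by
    refine NonlinearSpectrum.category_le_one_of_subset hcl hU ?_ (e := BV.one g) ?_ ?_
    · intro x hx hx'
      have h1 : 1 / 2 < normalizedVolume g {p | 0 < (-(x : BV g)).toL1 p} := hx'
      rw [hneg] at h1
      have h3 := ENNReal.add_lt_add (mem_ofPred.1 hx) h1
      rw [ENNReal.add_halves] at h3
      exact absurd (measure_pos_add_measure_neg_le_one (hae x)) (not_le.2 h3)
    -- If (1 - t)x + t = 0 almost everywhere, then `x` is positive almost nowhere: at a point with
    -- `x > 0` both terms are nonnegative, and they cannot both vanish.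
    · intro x hx t ht h0
      have h1 := BV.coeFn_smul_add_smul_one (1 - t) t (x : BV g)
      rw [h0, map_zero] at h1
      have h3 : ∀ᵐ p ∂(normalizedVolume g), ¬ 0 < (x : BV g).toL1 p := by
        filter_upwards [h1, Lp.coeFn_zero ℝ 1 (normalizedVolume g)] with p hp hp0 hpos
        rw [hp0, Pi.zero_apply] at hp
        have ht0 : 0 ≤ (1 - t) * (x : BV g).toL1 p := mul_nonneg (by linarith [ht.2]) hpos.le
        have : t = 0 := by linarith [ht.1]
        rw [this] at hp
        linarith
      have h4 : normalizedVolume g {p | 0 < (x : BV g).toL1 p} = 0 := by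
        simpa [ae_iff] using h3
      have h5 : 1 / 2 < normalizedVolume g {p | 0 < (x : BV g).toL1 p} := hx
      rw [h4] at h5
      exact not_lt_bot h5
    · intro a ha
      obtain ⟨x, rfl⟩ := NonlinearSpectrum.ProjectiveSpace.isQuotientMap_mk.surjective a
      rcases half_lt_measure_of_not_isMedian (hae x) (hcon x ha) with h | h
      · exact ⟨x, h, rfl⟩
      · refine ⟨-x, ?_, NonlinearSpectrum.ProjectiveSpace.mk_neg x⟩
        change 1 / 2 < normalizedVolume g {p | 0 < (-(x : BV g)).toL1 p}
        rwa [hneg]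
  exact absurd (h2.trans hcat) (by decide)

end Eigenvalue

end Cheeger

theorem mainTheorem6 {n : ℕ} {M : Type*} [TopologicalSpace M]
    [ChartedSpace (EuclideanSpace ℝ (Fin n)) M] [IsManifold (𝓡 n) ∞ M]
    [T2Space M] [CompactSpace M] [Nonempty M] [MeasurableSpace M] [BorelSpace M]
    (g : ContMDiffRiemannianMetric (𝓡 n) ∞ (EuclideanSpace ℝ (Fin n))
      (fun x : M => TangentSpace (𝓡 n) x)) :
    NonlinearSpectrum.kr (Cheeger.sphereEnergy g) 2 = Cheeger.cheegerConstant g ∧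
      NonlinearSpectrum.hs (Cheeger.projectiveEnergy g) 2 = Cheeger.cheegerConstant g := by
  have h1 := Cheeger.kr_le_cheegerConstant g
  have h2 := Cheeger.cheegerConstant_le_hs g
  have h3 : NonlinearSpectrum.hs (Cheeger.projectiveEnergy g) 2 ≤
      NonlinearSpectrum.kr (Cheeger.sphereEnergy g) 2 :=
    NonlinearSpectrum.hs_two_le_kr_two _ _
  exact ⟨le_antisymm h1 (h2.trans h3), le_antisymm (h3.trans h1) h2⟩
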